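/- **Setting.** A vertically rigid (VR) sub-Riemannian space is a smooth manifold $M^{n+1}$ with a smooth distribution $V_0\subset TM$ of rank $k+1$ carrying a smooth inner product $\langle\cdot,\cdot\rangle$, together with a smooth complement $V$ of $V_0$, a smooth global frame $T_1,\dots,T_{n-k}$ of $V$, a Riemannian metric $g$ extending $\langle\cdot,\cdot\rangle$ for which $V\perp V_0$ and the $T_j$ are orthonormal, and an equivalence relation $\sim$ on $\{1,\dots,n-k\}$ such that $g([X,T_j],T_i)=0$ for every smooth section $X$ of $V_0$ whenever $j\sim i$. A connection $\nabla$ on $TM$ is adapted if $\nabla g=0$, $\nabla T_j=0$ for all $j$, and $\mathrm{Tor}(X,Y)\in V$ for all $X,Y\in V_0$. Let $\Sigma$ be an (immersed) oriented $C^2$ hypersurface patch in $M$ with Riemannian unit normal $\nu_g$, and suppose that it is noncharacteristic: $V_0\not\subset T\Sigma$ at every point of $\Sigma$. Its horizontal unit normal $\nu$ is the normalized orthogonal projection of $\nu_g$ to $V_0$. Its horizontal mean curvature is the trace $H=\sum_{j=1}^k\langle\nabla_{e_j}\nu,e_j\rangle$ of the horizontal second fundamental form $II_0=(\langle\nabla_{e_i}\nu,e_j\rangle)_{i,j}$,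 where $e_1,\dots,e_k$ is an orthonormal basis of $V_0\cap T\Sigma$; $\Sigma$ is CMC($\rho$) if $H\equiv\rho$ on $\Sigma$. The horizontal curvature of a horizontal $C^2$ curve $c$ in $\Sigma$ is $k_c=\langle\nabla_{\dot c}\dot c,\nu\rangle$. **Corollary (CMC ruling).** Let $M$ be a VR space with $\dim V_0=2$, let $\nabla$ be an adapted connection, and let $\Sigma$ be a noncharacteristic CMC($\rho$) patch in $M$ as above. Denote by $\nu^\perp$ the horizontal unit vector field along $\Sigma$ orthogonal to $\nu$ (tangent to $\Sigma$, and determined locally up to sign). Then $\Sigma$ is ruled by the integral curves of $\nu^\perp$: it is the disjoint union of the images of such curves, each defined on an open interval. Moreover every integral curve $c$ of $\nu^\perp$ is a $C^2$ horizontal curve of constant horizontal curvature $\rho$ with respect to the normal $-\nu$, that is, $k_c=\langle\nabla_{\dot c}\dot c,\nu\rangle\equiv-\rho$. -/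

import Mathlib

open Bundle Set
open scoped Manifold ContDiff Topology InnerProductSpace

noncomputable section

section Structures

variable {E : Type*} [NormedAddCommGroup E] [NormedSpace ℝ E]
  {H : Type*} [TopologicalSpace H] (I : ModelWithCorners ℝ E H)
  (M : Type*) [TopologicalSpace M] [ChartedSpace H M] [IsManifold I ∞ M]

/-- A sub-Riemannian structure of rank `k + 1` on the manifold `M`: a smooth distribution `V₀` of
rank `k + 1` (locally spanned by a smooth frame), with a smooth inner product on it. -/
structure SubRiemannianStructure (k : ℕ) where
  /-- the horizontal distribution `V₀` -/
  V₀ : (x : M) → Submodule ℝ (TangentSpace I x)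
  exists_frame : ∀ x : M, ∃ u : Set M, IsOpen u ∧ x ∈ u ∧
    ∃ s : Fin (k + 1) → (y : M) → TangentSpace I y,
      (∀ i, ContMDiffOn I I.tangent ∞ (fun y ↦ (⟨y, s i y⟩ : TangentBundle I M)) u) ∧
      ∀ y ∈ u, LinearIndependent ℝ (fun i ↦ s i y) ∧
        Submodule.span ℝ (Set.range fun i ↦ s i y) = V₀ y
  /-- the inner product on the horizontal distribution -/
  metric : (x : M) → V₀ x →ₗ[ℝ] V₀ x →ₗ[ℝ] ℝ
  metric_symm : ∀ (x : M) (v w : V₀ x), metric x v w = metric x w v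
  metric_pos : ∀ (x : M) (v : V₀ x), v ≠ 0 → 0 < metric x v v
  metric_smooth : ∀ X Y : (x : M) → V₀ x,
    ContMDiff I I.tangent ∞ (fun x ↦ (⟨x, (X x : TangentSpace I x)⟩ : TangentBundle I M)) →
    ContMDiff I I.tangent ∞ (fun x ↦ (⟨x, (Y x : TangentSpace I x)⟩ : TangentBundle I M)) →
    ContMDiff I 𝓘(ℝ) ∞ (fun x ↦ metric x (X x) (Y x))

variable {I M} [RiemannianBundle (fun x : M ↦ TangentSpace I x)]

/-- A vertically rigid complement of a sub-Riemannian structure, with respect to the Riemannian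
metric `g` of `M` (the one carried by the `RiemannianBundle` instance): a smooth global orthonormal
frame `T` spanning a complement `V` of `V₀` that is orthogonal to `V₀`, where `g` extends the inner
product of `V₀`, and an equivalence relation on the indices of the frame (a partition) such that
`g([X, Tⱼ], Tᵢ) = 0` for all smooth horizontal `X` whenever `j ∼ i`. -/
structure VerticallyRigidComplement {k : ℕ} (S : SubRiemannianStructure I M k) (m : ℕ) where
  /-- the vertical frame `T₁, …, Tₘ` -/
  T : Fin m → (x : M) → TangentSpace I x
  T_smooth : ∀ i, ContMDiff I I.tangent ∞ (fun x ↦ (⟨x, T i x⟩ : TangentBundle I M))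
  T_orthonormal : ∀ x : M, Orthonormal ℝ (fun i ↦ T i x)
  isCompl : ∀ x : M, IsCompl (S.V₀ x) (Submodule.span ℝ (Set.range fun i ↦ T i x))
  orthogonal : ∀ (x : M), ∀ v ∈ S.V₀ x, ∀ i, ⟪v, T i x⟫_ℝ = 0
  metric_eq : ∀ (x : M) (v w : S.V₀ x),
    ⟪(v : TangentSpace I x), (w : TangentSpace I x)⟫_ℝ = S.metric x v w
  /-- the equivalence relation `∼` on the indices of the vertical frame -/
  rel : Setoid (Fin m)
  rigid : ∀ X : (x : M) → TangentSpace I x,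
    ContMDiff I I.tangent ∞ (fun x ↦ (⟨x, X x⟩ : TangentBundle I M)) → (∀ x, X x ∈ S.V₀ x) →
    ∀ i j : Fin m, rel.r j i → ∀ x : M, ⟪VectorField.mlieBracket I X (T j) x, T i x⟫_ℝ = 0

namespace VerticallyRigidComplement

variable {k m : ℕ} {S : SubRiemannianStructure I M k} (R : VerticallyRigidComplement S m)

/-- The vertical distribution `V`. -/
def V (x : M) : Submodule ℝ (TangentSpace I x) := Submodule.span ℝ (Set.range fun i ↦ R.T i x)

/-- The orthogonal projection of a tangent vector onto `V₀`; as `T` is an orthonormal frame of the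
orthogonal complement of `V₀`, it is obtained by subtracting the components along `T`. -/
def horizontalPart {x : M} (v : TangentSpace I x) : TangentSpace I x :=
  v - ∑ i, ⟪R.T i x, v⟫_ℝ • R.T i x

/-- A smooth connection on `TM` is adapted if it is metric, the vertical frame is parallel, and the
torsion of two horizontal vectors is vertical. (`cov Y x v` is `∇_v Y` at `x`.) -/
structure IsAdapted [FiniteDimensional ℝ E]
    (cov : CovariantDerivative I E (fun x : M ↦ TangentSpace I x)) : Prop where
  smooth : CovariantDerivative.ContMDiffCovariantDerivative cov ∞
  metric : ∀ (x : M) (Y Z : (x : M) → TangentSpace I x),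
    MDifferentiableAt I I.tangent (fun x ↦ (⟨x, Y x⟩ : TangentBundle I M)) x →
    MDifferentiableAt I I.tangent (fun x ↦ (⟨x, Z x⟩ : TangentBundle I M)) x →
    ∀ v : TangentSpace I x, mfderiv I 𝓘(ℝ) (fun x ↦ ⟪Y x, Z x⟫_ℝ) x v
      = ⟪cov Y x v, Z x⟫_ℝ + ⟪Y x, cov Z x v⟫_ℝ
  parallel : ∀ (i : Fin m) (x : M), cov (R.T i) x = 0
  torsion : ∀ (x : M), ∀ v ∈ S.V₀ x, ∀ w ∈ S.V₀ x, cov.torsion x v w ∈ R.V x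

end VerticallyRigidComplement

end Structures

section Along

variable {E : Type*} [NormedAddCommGroup E] [NormedSpace ℝ E]
  {H : Type*} [TopologicalSpace H] {I : ModelWithCorners ℝ E H}
  {M : Type*} [TopologicalSpace M] [ChartedSpace H M] [IsManifold I 1 M]
  {F : Type*} [NormedAddCommGroup F] [NormedSpace ℝ F]
  {G : Type*} [TopologicalSpace G] (J : ModelWithCorners ℝ F G)
  {N : Type*} [TopologicalSpace N] [ChartedSpace G N]

/-- The covariant derivative `D_u W` of a vector field `W` along a map `f : N → M` (the pullback
connection) in the direction `u ∈ T_y N`. If `Eₐ` is the local frame of `TM` given by the preferred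
trivialization at `f y` and `W = ∑ₐ Wᵃ (Eₐ ∘ f)`, then
`D_u W = ∑ₐ dWᵃ(u) Eₐ + ∑ₐ Wᵃ ∇_{df(u)} Eₐ`; the section `FiberBundle.extend E (W y)` is the
combination of the `Eₐ` with the constant coefficients `Wᵃ(y)`. -/
def covDerivAlong (cov : CovariantDerivative I E (fun x : M ↦ TangentSpace I x))
    (f : N → M) (W : (y : N) → TangentSpace I (f y)) (y : N) (u : TangentSpace J y) :
    TangentSpace I (f y) :=
  (trivializationAt E (TangentSpace I) (f y)).symmL ℝ (f y)
      (mfderiv J 𝓘(ℝ, E)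
        (fun z ↦ (trivializationAt E (TangentSpace I) (f y)
          (⟨f z, W z⟩ : TangentBundle I M)).2) y u)
    + cov (FiberBundle.extend E (W y)) (f y) (mfderiv J I f y u)

/-- The velocity `ċ(t)` of a curve `c` in `M`. -/
def velocity (I : ModelWithCorners ℝ E H) {M : Type*} [TopologicalSpace M] [ChartedSpace H M]
    (c : ℝ → M) (t : ℝ) : TangentSpace I (c t) :=
  mfderiv 𝓘(ℝ) I c t (1 : ℝ)

end Along

section Hypersurfaces

variable {E : Type*} [NormedAddCommGroup E] [NormedSpace ℝ E]
  {H : Type*} [TopologicalSpace H] {I : ModelWithCorners ℝ E H}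
  {M : Type*} [TopologicalSpace M] [ChartedSpace H M] [IsManifold I ∞ M]
  [RiemannianBundle (fun x : M ↦ TangentSpace I x)]
  {F : Type*} [NormedAddCommGroup F] [NormedSpace ℝ F]
  {G : Type*} [TopologicalSpace G] (J : ModelWithCorners ℝ F G)
  {N : Type*} [TopologicalSpace N] [ChartedSpace G N]
  {k m : ℕ} {S : SubRiemannianStructure I M k} (R : VerticallyRigidComplement S m)
  (ι : N → M) (νg : (y : N) → TangentSpace I (ι y))

/-- `νg` is a continuous Riemannian unit normal field (an orientation) of the hypersurface `ι`. -/
structure IsUnitNormal : Prop where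
  continuous : Continuous (fun y ↦ (⟨ι y, νg y⟩ : TangentBundle I M))
  norm_eq_one : ∀ y, ‖νg y‖ = 1
  orthogonal : ∀ (y : N) (u : TangentSpace J y), ⟪νg y, mfderiv J I ι y u⟫_ℝ = 0

/-- A point of a hypersurface is noncharacteristic if the tangent space of the hypersurface does not
contain the horizontal space. -/
def IsNoncharacteristicAt (S : SubRiemannianStructure I M k) (ι : N → M) (y : N) : Prop :=
  ¬ S.V₀ (ι y) ≤ LinearMap.range (mfderiv J I ι y).toLinearMap

/-- The horizontal unit normal `ν`: the normalized horizontal part of the Riemannian normal. -/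
def horizontalNormal (y : N) : TangentSpace I (ι y) :=
  ‖R.horizontalPart (νg y)‖⁻¹ • R.horizontalPart (νg y)

/-- `e₁, …, eₖ` is an orthonormal family of horizontal tangent vectors of the hypersurface at `y`
(at a noncharacteristic point these are the orthonormal bases of `V₀ ∩ TΣ`, of dimension `k`). -/
structure IsHorizontalTangentFrame (S : SubRiemannianStructure I M k) (ι : N → M) (y : N)
    (e : Fin k → TangentSpace J y) : Prop where
  horizontal : ∀ i, mfderiv J I ι y (e i) ∈ S.V₀ (ι y)
  orthonormal : Orthonormal ℝ (fun i ↦ mfderiv J I ι y (e i))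

/-- The matrix `⟨∇_{eᵢ} ν, eⱼ⟩` of the horizontal second fundamental form `II₀` at `y` with respect
to a horizontal tangent frame. -/
def secondFundamentalForm (cov : CovariantDerivative I E (fun x : M ↦ TangentSpace I x)) (y : N)
    (e : Fin k → TangentSpace J y) : Matrix (Fin k) (Fin k) ℝ :=
  Matrix.of fun i j ↦
    ⟪covDerivAlong J cov ι (horizontalNormal R ι νg) y (e i), mfderiv J I ι y (e j)⟫_ℝ

/-- The noncharacteristic hypersurface is CMC(`ρ`): the horizontal mean curvature, the trace of
`II₀` (in any frame), is equal to `ρ` everywhere. -/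
def IsCMC (cov : CovariantDerivative I E (fun x : M ↦ TangentSpace I x)) (ρ : ℝ) : Prop :=
  ∀ (y : N) (e : Fin k → TangentSpace J y), IsHorizontalTangentFrame J S ι y e →
    (secondFundamentalForm J R ι νg cov y e).trace = ρ

/-- The curve `γ` in the hypersurface is, on the parameter set `A`, an integral curve of `ν^⊥`:
it is `C¹` and its velocity is a horizontal unit vector orthogonal to `ν`. -/
structure IsPerpCurveOn (γ : ℝ → N) (A : Set ℝ) : Prop where
  contMDiffOn : ContMDiffOn 𝓘(ℝ) J 1 γ A
  horizontal : ∀ t ∈ A, velocity I (ι ∘ γ) t ∈ S.V₀ (ι (γ t))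
  norm_eq_one : ∀ t ∈ A, ‖velocity I (ι ∘ γ) t‖ = 1
  orthogonal : ∀ t ∈ A,
    inner ℝ (E := TangentSpace I (ι (γ t))) (velocity I (ι ∘ γ) t) (horizontalNormal R ι νg (γ t))
      = 0

/-- The horizontal curvature `⟨∇_ċ ċ, ν⟩` at time `t` of the curve `c = ι ∘ γ`. -/
def horizontalCurvature (cov : CovariantDerivative I E (fun x : M ↦ TangentSpace I x))
    (γ : ℝ → N) (t : ℝ) : ℝ :=
  inner ℝ (E := TangentSpace I (ι (γ t)))
    (covDerivAlong 𝓘(ℝ) cov (ι ∘ γ) (velocity I (ι ∘ γ)) t (1 : ℝ))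
    (horizontalNormal R ι νg (γ t))

end Hypersurfaces

end

section LineFields

open Filter

variable {F : Type*} [NormedAddCommGroup F] [NormedSpace ℝ F]
  {G : Type*} [TopologicalSpace G] {J : ModelWithCorners ℝ F G}
  {N : Type*} [TopologicalSpace N] [ChartedSpace G N]

/-- An integral curve of a `C¹` vector field is `C²`. -/
theorem IsMIntegralCurveAt.contMDiffAt_two [IsManifold J 2 N] {γ : ℝ → N}
    {U : (y : N) → TangentSpace J y} {t₀ : ℝ} (hγ : IsMIntegralCurveAt γ U t₀)
    (hU : ContMDiffAt J J.tangent 1 (fun y ↦ (⟨y, U y⟩ : TangentBundle J N)) (γ t₀)) :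
    ContMDiffAt 𝓘(ℝ) J 2 γ t₀ := by
  have : IsManifold J 1 N := .of_le (n := 2) (by norm_num)
  set V : N → F := fun y ↦ (trivializationAt F (TangentSpace J) (γ t₀) ⟨y, U y⟩).2 with hV
  have hV1 : ContMDiffAt J 𝓘(ℝ, F) 1 V (γ t₀) := (contMDiffAt_section (γ t₀)).1 hU
  have hcont : ∀ᶠ t in 𝓝 t₀, ContinuousAt γ t := by
    filter_upwards [hγ] with t ht using ht.1
  have hder : ∀ᶠ t in 𝓝 t₀, HasFDerivAt (extChartAt J (γ t₀) ∘ γ)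
      ((1 : ℝ →L[ℝ] ℝ).smulRight (V (γ t))) t := by
    filter_upwards [hγ.eventually_hasDerivAt] with t ht
    exact ht.hasFDerivAt
  have step : ∀ k : ℕ, ContMDiffAt 𝓘(ℝ) 𝓘(ℝ, F) k (V ∘ γ) t₀ →
      ContMDiffAt 𝓘(ℝ) J (k + 1 : ℕ) γ t₀ := by
    intro k hk
    refine contMDiffAt_iff_target.2 ⟨hγ.continuousAt, ?_⟩
    rw [contMDiffAt_iff_contDiffAt] at hk ⊢
    push_cast
    refine contDiffAt_succ_iff_hasFDerivAt.2 ⟨_, eventually_iff_exists_mem.1 hder, ?_⟩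
    exact contDiffAt_const.smulRight hk
  have h0 : ContMDiffAt 𝓘(ℝ) 𝓘(ℝ, F) (0 : ℕ) (V ∘ γ) t₀ := by
    rw [contMDiffAt_iff_contDiffAt]
    have hVc : ∀ᶠ y in 𝓝 (γ t₀), ContinuousAt V y := by
      filter_upwards [(contMDiffAt_iff_contMDiffAt_nhds (by norm_num)).1 hV1] with y hy
        using hy.continuousAt
    have : ∀ᶠ t in 𝓝 t₀, ContinuousAt (V ∘ γ) t := by
      filter_upwards [hcont, hγ.continuousAt.eventually hVc] with t h1 h2
      exact ContinuousAt.comp h2 h1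
    obtain ⟨u, hu, h⟩ := eventually_iff_exists_mem.1 this
    exact contDiffAt_zero.2 ⟨u, hu, fun t ht ↦ (h t ht).continuousWithinAt⟩
  have h1 : ContMDiffAt 𝓘(ℝ) J 1 γ t₀ := by simpa using step 0 h0
  have := step 1 (hV1.comp t₀ h1)
  norm_num at this
  exact this

variable (J) in
/-- A `C¹` line field on a manifold, given by its pairs of opposite nonzero spanning vectors. -/
structure IsLineField [IsManifold J 1 N] (P : (y : N) → TangentSpace J y → Prop) : Prop where
  neg : ∀ y a, P y a → P y (-a)
  eq_or_eq_neg : ∀ y a b, P y a → P y b → a = b ∨ a = -b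
  ne_zero : ∀ y a, P y a → a ≠ 0
  exists_local : ∀ y₀ : N, ∃ U : (y : N) → TangentSpace J y,
    ContMDiffAt J J.tangent 1 (fun y ↦ (⟨y, U y⟩ : TangentBundle J N)) y₀ ∧
    ∀ᶠ y in 𝓝 y₀, P y (U y)

/-- The velocity of a curve. -/
noncomputable def curveDeriv (J : ModelWithCorners ℝ F G) (γ : ℝ → N) (t : ℝ) :
    TangentSpace J (γ t) :=
  mfderiv 𝓘(ℝ) J γ t (1 : ℝ)

/-- The curve `γ` is `C¹` on `A` and its derivative spans the line field `P`. -/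
structure IsLineCurve (P : (y : N) → TangentSpace J y → Prop) (γ : ℝ → N) (A : Set ℝ) :
    Prop where
  isOpen : IsOpen A
  ordConnected : A.OrdConnected
  contMDiffAt : ∀ t ∈ A, ContMDiffAt 𝓘(ℝ) J 1 γ t
  deriv_mem : ∀ t ∈ A, P (γ t) (curveDeriv J γ t)

variable {P : (y : N) → TangentSpace J y → Prop}

theorem IsLineField.exists_local_eq [IsManifold J 1 N] (hP : IsLineField J P) {y₀ : N}
    {a : TangentSpace J y₀}
    (ha : P y₀ a) : ∃ U : (y : N) → TangentSpace J y,
    ContMDiffAt J J.tangent 1 (fun y ↦ (⟨y, U y⟩ : TangentBundle J N)) y₀ ∧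
    (∀ᶠ y in 𝓝 y₀, P y (U y)) ∧ U y₀ = a := by
  obtain ⟨U, hU, hPU⟩ := hP.exists_local y₀
  rcases hP.eq_or_eq_neg y₀ _ _ hPU.self_of_nhds ha with h | h
  · exact ⟨U, hU, hPU, h⟩
  · refine ⟨fun y ↦ -U y, hU.neg_section, hPU.mono fun y hy ↦ hP.neg _ _ hy, by simp [h]⟩

theorem hasMFDerivAt_curveDeriv {γ : ℝ → N} {t : ℝ} (h : MDifferentiableAt 𝓘(ℝ) J γ t) :
    HasMFDerivAt 𝓘(ℝ) J γ t ((1 : ℝ →L[ℝ] ℝ).smulRight (curveDeriv J γ t)) := by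
  have h2 : mfderiv 𝓘(ℝ) J γ t = (1 : ℝ →L[ℝ] ℝ).smulRight (curveDeriv J γ t) :=
    ContinuousLinearMap.ext_ring (one_smul ℝ (curveDeriv J γ t)).symm
  exact h2 ▸ h.hasMFDerivAt

theorem curveDeriv_eq {γ : ℝ → N} {t : ℝ} {a : TangentSpace J (γ t)}
    (h : HasMFDerivAt 𝓘(ℝ) J γ t ((1 : ℝ →L[ℝ] ℝ).smulRight a)) : curveDeriv J γ t = a := by
  rw [curveDeriv, h.mfderiv]
  exact one_smul ℝ a

/-- The derivative of a map, applied to a vector field, is a `C^m` vector field along the map. -/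
theorem ContMDiffAt.mfderiv_apply_section
    {E' : Type*} [NormedAddCommGroup E'] [NormedSpace ℝ E']
    {H' : Type*} [TopologicalSpace H'] {I' : ModelWithCorners ℝ E' H'}
    {M' : Type*} [TopologicalSpace M'] [ChartedSpace H' M'] [IsManifold I' 1 M']
    [IsManifold J 1 N] {f : N → M'} {y₀ : N} {m n : ℕ∞ω} (hf : ContMDiffAt J I' n f y₀)
    (hmn : m + 1 ≤ n) {v : (y : N) → TangentSpace J y}
    (hv : ContMDiffAt J J.tangent m (fun y ↦ (⟨y, v y⟩ : TangentBundle J N)) y₀) :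
    ContMDiffAt J I'.tangent m
      (fun y ↦ (⟨f y, mfderiv J I' f y (v y)⟩ : TangentBundle I' M')) y₀ :=
  ContMDiffAt.clm_apply_of_inCoordinates (hf.mfderiv_const hmn) hv
    (hf.of_le (le_self_add.trans hmn))

theorem ContMDiffAt.curveDeriv [IsManifold J 1 N] {γ : ℝ → N} {t₀ : ℝ} {m n : ℕ∞ω}
    (h : ContMDiffAt 𝓘(ℝ) J n γ t₀) (hmn : m + 1 ≤ n) :
    ContMDiffAt 𝓘(ℝ) J.tangent m
      (fun t ↦ (⟨γ t, curveDeriv J γ t⟩ : TangentBundle J N)) t₀ := by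
  refine h.mfderiv_apply_section hmn (v := fun t ↦ (1 : ℝ)) ?_
  refine (contMDiffAt_section t₀).2 ((contMDiffAt_const (c := (1 : ℝ))).congr_of_eventuallyEq ?_)
  exact .of_forall fun t ↦
    congrArg Prod.snd (trivializationAt_model_space_apply (I := 𝓘(ℝ)) ⟨t, (1 : ℝ)⟩ t₀)

theorem continuousAt_curveDeriv [IsManifold J 1 N] {γ : ℝ → N} {t₀ : ℝ}
    (h : ContMDiffAt 𝓘(ℝ) J 1 γ t₀) :
    ContinuousAt
      (fun t ↦ (trivializationAt F (TangentSpace J) (γ t₀) ⟨γ t, curveDeriv J γ t⟩).2) t₀ :=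
  (contMDiffAt_totalSpace.1 (h.curveDeriv (m := 0) (by norm_num))).2.continuousAt

/-- Near each of its points, a curve of a line field is an integral curve of a local section. -/
theorem IsLineCurve.isMIntegralCurveAt [IsManifold J 1 N] (hP : IsLineField J P) {γ : ℝ → N}
    {A : Set ℝ} (hγ : IsLineCurve P γ A) {t₀ : ℝ} (ht₀ : t₀ ∈ A)
    {U : (y : N) → TangentSpace J y}
    (hU : ContMDiffAt J J.tangent 1 (fun y ↦ (⟨y, U y⟩ : TangentBundle J N)) (γ t₀))
    (hPU : ∀ᶠ y in 𝓝 (γ t₀), P y (U y)) (h0 : U (γ t₀) = curveDeriv J γ t₀) :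
    IsMIntegralCurveAt γ U t₀ := by
  set e := trivializationAt F (TangentSpace J) (γ t₀)
  have hc := continuousAt_curveDeriv (hγ.contMDiffAt t₀ ht₀)
  have hγc := (hγ.contMDiffAt t₀ ht₀).continuousAt
  have hV : ContinuousAt (fun t ↦ (e ⟨γ t, U (γ t)⟩).2) t₀ :=
    ContinuousAt.comp (g := fun y ↦ (e ⟨y, U y⟩).2)
      ((contMDiffAt_section (γ t₀)).1 hU).continuousAt hγc
  have hmem : γ t₀ ∈ e.baseSet := mem_baseSet_trivializationAt F (TangentSpace J) (γ t₀)
  have hsum : ∀ᶠ t in 𝓝 t₀, (e ⟨γ t, curveDeriv J γ t⟩).2 + (e ⟨γ t, U (γ t)⟩).2 ≠ 0 := by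
    refine (hc.add hV).eventually_ne ?_
    simp only [Pi.add_apply]
    rw [h0, ← two_smul ℝ]
    refine smul_ne_zero two_ne_zero fun h ↦ hP.ne_zero _ _ (hγ.deriv_mem t₀ ht₀) ?_
    exact (e.linearEquivAt ℝ _ hmem).map_eq_zero_iff.1 h
  filter_upwards [hsum, hγc.eventually hPU, hγ.isOpen.mem_nhds ht₀,
    hγc.eventually (e.open_baseSet.mem_nhds hmem)] with t h1 h2 h3 h4
  have key : curveDeriv J γ t = U (γ t) := by
    rcases hP.eq_or_eq_neg _ _ _ (hγ.deriv_mem t h3) h2 with h | h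
    · exact h
    · refine absurd ?_ h1
      rw [h, (e.linear ℝ h4).map_neg, neg_add_cancel]
  rw [← key]
  exact hasMFDerivAt_curveDeriv ((hγ.contMDiffAt t h3).mdifferentiableAt (by norm_num))

theorem IsLineCurve.contMDiffAt_two [IsManifold J 2 N] (hP : IsLineField J P) {γ : ℝ → N}
    {A : Set ℝ} (hγ : IsLineCurve P γ A) {t₀ : ℝ} (ht₀ : t₀ ∈ A) :
    ContMDiffAt 𝓘(ℝ) J 2 γ t₀ := by
  have : IsManifold J 1 N := .of_le (n := 2) (by norm_num)
  obtain ⟨U, hU, hPU, h⟩ := hP.exists_local_eq (hγ.deriv_mem t₀ ht₀)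
  exact (hγ.isMIntegralCurveAt hP ht₀ hU hPU h).contMDiffAt_two hU

end LineFields

section LineFieldLeaves

open Filter

variable {F : Type*} [NormedAddCommGroup F] [NormedSpace ℝ F]
  {G : Type*} [TopologicalSpace G] {J : ModelWithCorners ℝ F G}
  {N : Type*} [TopologicalSpace N] [ChartedSpace G N]

/-- The curve of the velocities of a curve, in the tangent bundle. -/
noncomputable def tangentLift (J : ModelWithCorners ℝ F G) (γ : ℝ → N) (t : ℝ) : TangentBundle J N :=
  ⟨γ t, curveDeriv J γ t⟩

theorem Filter.EventuallyEq.tangentLift_eq {γ δ : ℝ → N} {t : ℝ} (h : γ =ᶠ[𝓝 t] δ) :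
    tangentLift J γ t = tangentLift J δ t :=
  TotalSpace.ext h.eq_of_nhds (heq_of_eq (congrArg (fun L : ℝ →L[ℝ] F ↦ L 1) h.mfderiv_eq))

theorem IsMIntegralCurveAt.tangentLift_eq {γ : ℝ → N} {t : ℝ} {U : (y : N) → TangentSpace J y}
    (h : IsMIntegralCurveAt γ U t) : tangentLift J γ t = ⟨γ t, U (γ t)⟩ := by
  rw [tangentLift, curveDeriv_eq h.hasMFDerivAt]

variable {P : (y : N) → TangentSpace J y → Prop}

theorem IsLineCurve.congr {γ : ℝ → N} {A : Set ℝ} (h : ∀ t ∈ A, ∃ δ B, IsLineCurve P δ B ∧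
    t ∈ B ∧ γ =ᶠ[𝓝 t] δ) (hA : IsOpen A) (hA' : A.OrdConnected) : IsLineCurve P γ A where
  isOpen := hA
  ordConnected := hA'
  contMDiffAt t ht := by
    obtain ⟨δ, B, hδ, htB, heq⟩ := h t ht
    exact (hδ.contMDiffAt t htB).congr_of_eventuallyEq heq
  deriv_mem t ht := by
    obtain ⟨δ, B, hδ, htB, heq⟩ := h t ht
    have h1 : (fun p : TangentBundle J N ↦ P p.1 p.2) (tangentLift J δ t) := hδ.deriv_mem t htB
    rw [← heq.tangentLift_eq (J := J)] at h1
    exact h1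

theorem curveDeriv_comp_affine {γ : ℝ → N} {c s t : ℝ}
    (h : MDifferentiableAt 𝓘(ℝ) J γ (c * t + s)) :
    curveDeriv J (fun t ↦ γ (c * t + s)) t = c • curveDeriv J γ (c * t + s) := by
  have h1 : HasFDerivAt (fun t : ℝ ↦ c * t + s) ((1 : ℝ →L[ℝ] ℝ).smulRight c) t := by
    have := (((hasDerivAt_id t).const_mul c).add_const s).hasFDerivAt
    rw [mul_one] at this
    exact this
  have h2 := (HasMFDerivAt.comp t (hasMFDerivAt_curveDeriv h) h1.hasMFDerivAt).mfderiv
  rw [curveDeriv]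
  change mfderiv 𝓘(ℝ) J (γ ∘ fun t ↦ c * t + s) t (1 : ℝ) = _
  rw [h2]
  change ((1 : ℝ) • c) • curveDeriv J γ (c * t + s) = _
  rw [one_smul]

variable [IsManifold J 1 N]

theorem IsLineCurve.comp_affine (hP : IsLineField J P) {γ : ℝ → N} {A : Set ℝ}
    (hγ : IsLineCurve P γ A) {c : ℝ} (hc : c = 1 ∨ c = -1) (s : ℝ) :
    IsLineCurve P (fun t ↦ γ (c * t + s)) ((fun t ↦ c * t + s) ⁻¹' A) where
  isOpen := hγ.isOpen.preimage (by fun_prop)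
  ordConnected := by
    rcases hc with rfl | rfl
    · exact hγ.ordConnected.preimage_mono fun a b h ↦ by simpa using h
    · exact hγ.ordConnected.preimage_anti fun a b h ↦ by linarith
  contMDiffAt t ht := by
    refine ContMDiffAt.comp (g := γ) t (hγ.contMDiffAt _ ht) ?_
    rw [contMDiffAt_iff_contDiffAt]
    fun_prop
  deriv_mem t ht := by
    rw [curveDeriv_comp_affine ((hγ.contMDiffAt _ ht).mdifferentiableAt (by norm_num))]
    rcases hc with rfl | rfl
    · rw [one_smul]; exact hγ.deriv_mem _ ht
    · rw [neg_one_smul]; exact hP.neg _ _ (hγ.deriv_mem _ ht)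

theorem IsLineField.exists_isLineCurve [IsManifold J 2 N] [CompleteSpace F]
    [BoundarylessManifold J N]
    (hP : IsLineField J P) {y : N} {a : TangentSpace J y} (ha : P y a) :
    ∃ γ A, IsLineCurve P γ A ∧ 0 ∈ A ∧ tangentLift J γ 0 = ⟨y, a⟩ := by
  obtain ⟨U, hU, hPU, rfl⟩ := hP.exists_local_eq ha
  obtain ⟨γ, rfl, hγ⟩ := exists_isMIntegralCurveAt_of_contMDiffAt_boundaryless 0 hU
  have h2 := (contMDiffAt_iff_contMDiffAt_nhds (by norm_num)).1 (hγ.contMDiffAt_two hU)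
  obtain ⟨ε, hε, h⟩ := Metric.eventually_nhds_iff_ball.1
    ((h2.and hγ).and (hγ.continuousAt.eventually hPU))
  refine ⟨γ, Metric.ball 0 ε, ⟨Metric.isOpen_ball, ?_, fun t ht ↦ ?_, fun t ht ↦ ?_⟩,
    Metric.mem_ball_self hε, hγ.tangentLift_eq⟩
  · rw [Real.ball_eq_Ioo]; exact ordConnected_Ioo
  · exact (h t ht).1.1.of_le (by norm_num)
  · rw [curveDeriv_eq (h t ht).1.2]
    exact (h t ht).2

theorem IsLineCurve.exists_reparametrization (hP : IsLineField J P) {γ : ℝ → N} {A : Set ℝ}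
    (hγ : IsLineCurve P γ A) {y : N} (hy : y ∈ γ '' A) {a : TangentSpace J y} (ha : P y a) :
    ∃ δ B, IsLineCurve P δ B ∧ 0 ∈ B ∧ tangentLift J δ 0 = ⟨y, a⟩ ∧ δ '' B = γ '' A := by
  obtain ⟨s, hs, rfl⟩ := hy
  have key : ∀ c : ℝ, c = 1 ∨ c = -1 → c • curveDeriv J γ s = a →
      ∃ δ B, IsLineCurve P δ B ∧ 0 ∈ B ∧ tangentLift J δ 0 = ⟨γ s, a⟩ ∧ δ '' B = γ '' A := by
    rintro c hc rfl
    refine ⟨_, _, hγ.comp_affine hP hc s, by simpa using hs, ?_, ?_⟩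
    · rw [tangentLift, curveDeriv_comp_affine
        ((hγ.contMDiffAt _ (by simpa using hs)).mdifferentiableAt (by norm_num))]
      rw [show c * 0 + s = s by ring]
    · have hc0 : c ≠ 0 := by rcases hc with rfl | rfl <;> norm_num
      change (γ ∘ fun t ↦ c * t + s) '' _ = _
      rw [image_comp, image_preimage_eq]
      exact fun x ↦ ⟨(x - s) / c, by field_simp; ring⟩
  rcases hP.eq_or_eq_neg _ _ _ ha (hγ.deriv_mem s hs) with h | h
  · exact key 1 (.inl rfl) (by rw [h, one_smul])
  · exact key (-1) (.inr rfl) (by rw [h, neg_one_smul])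

variable [BoundarylessManifold J N]

theorem IsLineCurve.eventuallyEq (hP : IsLineField J P) {γ δ : ℝ → N} {A B : Set ℝ}
    (hγ : IsLineCurve P γ A) (hδ : IsLineCurve P δ B) {t : ℝ} (hA : t ∈ A) (hB : t ∈ B)
    (h : tangentLift J γ t = tangentLift J δ t) : γ =ᶠ[𝓝 t] δ := by
  obtain ⟨U, hU, hPU, hUt⟩ := hP.exists_local_eq (hγ.deriv_mem t hA)
  have h0 : γ t = δ t := congrArg TotalSpace.proj h
  refine isMIntegralCurveAt_eventuallyEq_of_contMDiffAt_boundaryless hU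
    (hγ.isMIntegralCurveAt hP hA hU hPU hUt) ?_ h0
  refine hδ.isMIntegralCurveAt hP hB (h0 ▸ hU) (h0 ▸ hPU) ?_
  have h1 : (⟨δ t, U (δ t)⟩ : TangentBundle J N) = tangentLift J δ t := by
    rw [← h, ← h0, hUt, tangentLift]
  exact TotalSpace.mk_injective _ h1

variable [T2Space N]

/-- Two curves of a line field with a common velocity coincide. -/
theorem IsLineCurve.eqOn (hP : IsLineField J P) {γ δ : ℝ → N} {A B : Set ℝ}
    (hγ : IsLineCurve P γ A) (hδ : IsLineCurve P δ B) {t₀ : ℝ} (hA : t₀ ∈ A) (hB : t₀ ∈ B)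
    (h : tangentLift J γ t₀ = tangentLift J δ t₀) : EqOn γ δ (A ∩ B) := by
  set s : Set ℝ := {t | t ∈ A ∩ B ∧ tangentLift J γ t = tangentLift J δ t} with hs
  have hopen : IsOpen s := by
    rw [isOpen_iff_mem_nhds]
    rintro t ⟨ht, hlift⟩
    filter_upwards [(hγ.isOpen.inter hδ.isOpen).mem_nhds ht,
      (hγ.eventuallyEq hP hδ ht.1 ht.2 hlift).eventually_nhds] with r hr hr'
    exact ⟨hr, Filter.EventuallyEq.tangentLift_eq hr'⟩
  have hclosed : closure s ∩ (A ∩ B) ⊆ s := by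
    rintro t ⟨hcl, ht⟩
    refine ⟨ht, ?_⟩
    have hfreq : ∃ᶠ r in 𝓝 t, r ∈ s := mem_closure_iff_frequently.1 hcl
    have hγt := (hγ.contMDiffAt t ht.1).continuousAt
    have h0 : γ t = δ t := tendsto_nhds_unique_of_frequently_eq hγt
      (hδ.contMDiffAt t ht.2).continuousAt
      (hfreq.mono fun r hr ↦ congrArg TotalSpace.proj hr.2)
    obtain ⟨b, hb, hPb⟩ : ∃ b : TangentSpace J (γ t), tangentLift J δ t = ⟨γ t, b⟩ ∧ P (γ t) b := by
      rw [h0]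
      exact ⟨_, rfl, hδ.deriv_mem t ht.2⟩
    rcases hP.eq_or_eq_neg _ _ _ hPb (hγ.deriv_mem t ht.1) with rfl | rfl
    · exact hb.symm
    · exfalso
      obtain ⟨U, hU, hPU, hUt⟩ := hP.exists_local_eq (hγ.deriv_mem t ht.1)
      have h1 := hγ.isMIntegralCurveAt hP ht.1 hU hPU hUt
      have h2 : IsMIntegralCurveAt δ (fun y ↦ -U y) t := by
        refine hδ.isMIntegralCurveAt hP ht.2 (h0 ▸ hU.neg_section)
          (h0 ▸ hPU.mono fun y hy ↦ hP.neg _ _ hy) ?_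
        have h1 : (⟨δ t, -U (δ t)⟩ : TangentBundle J N) = tangentLift J δ t := by
          rw [hb, ← h0, hUt]
        exact TotalSpace.mk_injective _ h1
      obtain ⟨r, hr, hr1, hr2, hr3⟩ := (hfreq.and_eventually
        (h1.eventually_nhds.and (h2.eventually_nhds.and (hγt.eventually hPU)))).exists
      have h3 := hr.2
      have hr0 : γ r = δ r := congrArg TotalSpace.proj h3
      rw [IsMIntegralCurveAt.tangentLift_eq hr1,
        IsMIntegralCurveAt.tangentLift_eq (U := fun y ↦ -U y) hr2, ← hr0] at h3
      have h4 : ∀ v : F, v = -v → v = 0 := fun v hv ↦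
        (smul_eq_zero_iff_right (two_ne_zero (α := ℝ))).1 <| by
          rw [two_smul, ← eq_neg_iff_add_eq_zero, ← hv]
      exact hP.ne_zero _ _ hr3 (h4 _ (TotalSpace.mk_injective _ h3))
  have hsub : A ∩ B ⊆ s :=
    (hγ.ordConnected.inter hδ.ordConnected).isPreconnected.subset_of_closure_inter_subset hopen
      ⟨t₀, ⟨hA, hB⟩, ⟨hA, hB⟩, h⟩ hclosed
  exact fun t ht ↦ congrArg TotalSpace.proj (hsub ht).2

/-- Maximal curves of a line field. -/
theorem IsLineField.exists_maximal [IsManifold J 2 N] [CompleteSpace F]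
    (hP : IsLineField J P) {y : N} {a : TangentSpace J y} (ha : P y a) :
    ∃ γ A, IsLineCurve P γ A ∧ 0 ∈ A ∧ tangentLift J γ 0 = ⟨y, a⟩ ∧
      ∀ δ B, IsLineCurve P δ B → 0 ∈ B → tangentLift J δ 0 = ⟨y, a⟩ → B ⊆ A ∧ EqOn δ γ B := by
  let C : Set ((ℝ → N) × Set ℝ) :=
    {q | IsLineCurve P q.1 q.2 ∧ 0 ∈ q.2 ∧ tangentLift J q.1 0 = ⟨y, a⟩}
  have hex : ∀ t, t ∈ ⋃ q ∈ C, q.2 → ∃ q ∈ C, t ∈ q.2 := fun t ht ↦ by simpa using ht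
  have : Nonempty N := ⟨y⟩
  choose! Q hQC hQ using hex
  let γ : ℝ → N := fun t ↦ (Q t).1 t
  have heq : ∀ q ∈ C, EqOn q.1 γ q.2 := by
    intro q hq t ht
    have htA : t ∈ ⋃ q ∈ C, q.2 := mem_biUnion hq ht
    have h1 := hQC t htA
    exact hq.1.eqOn hP h1.1 hq.2.1 h1.2.1 (hq.2.2.trans h1.2.2.symm) ⟨ht, hQ t htA⟩
  have hev : ∀ q ∈ C, ∀ t ∈ q.2, γ =ᶠ[𝓝 t] q.1 := fun q hq t ht ↦ by
    filter_upwards [hq.1.isOpen.mem_nhds ht] with r hr using (heq q hq hr).symm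
  obtain ⟨γ₀, A₀, h1, h2, h3⟩ := hP.exists_isLineCurve ha
  have hq0 : (γ₀, A₀) ∈ C := ⟨h1, h2, h3⟩
  refine ⟨γ, ⋃ q ∈ C, q.2, IsLineCurve.congr (fun t ht ↦ ?_) ?_ ?_,
    mem_biUnion hq0 h2, ?_, fun δ B h4 h5 h6 ↦
      ⟨subset_biUnion_of_mem (u := Prod.snd) (show (δ, B) ∈ C from ⟨h4, h5, h6⟩),
        heq (δ, B) ⟨h4, h5, h6⟩⟩⟩
  · exact ⟨_, _, (hQC t ht).1, hQ t ht, hev _ (hQC t ht) t (hQ t ht)⟩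
  · exact isOpen_biUnion fun q hq ↦ hq.1.isOpen
  · rw [← sUnion_image]
    refine (isPreconnected_sUnion 0 _ ?_ ?_).ordConnected
    · rintro _ ⟨q, hq, rfl⟩
      exact hq.2.1
    · rintro _ ⟨q, hq, rfl⟩
      exact hq.1.ordConnected.isPreconnected
  · rw [(hev _ hq0 0 h2).tangentLift_eq, h3]

/-- A manifold with a line field is the disjoint union of images of curves of the line field. -/
theorem IsLineField.exists_isPartition [IsManifold J 2 N] [CompleteSpace F]
    (hP : IsLineField J P) :
    ∃ leaves : Set (Set N), Setoid.IsPartition leaves ∧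
      ∀ L ∈ leaves, ∃ γ A, IsLineCurve P γ A ∧ L = γ '' A := by
  have hvec : ∀ y, ∃ a, P y a := fun y ↦
    let ⟨U, _, h⟩ := hP.exists_local y
    ⟨_, h.self_of_nhds⟩
  choose a ha using hvec
  choose γ A hγ h0 hlift hmax using fun y ↦ hP.exists_maximal (ha y)
  have hself : ∀ y, y ∈ γ y '' A y := fun y ↦
    ⟨0, h0 y, congrArg TotalSpace.proj (hlift y)⟩
  have hsub : ∀ {δ : ℝ → N} {B : Set ℝ}, IsLineCurve P δ B → ∀ y ∈ δ '' B,
      δ '' B ⊆ γ y '' A y := by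
    intro δ B hδ y hy
    obtain ⟨δ', B', h1, h2, h3, h4⟩ := hδ.exists_reparametrization hP hy (ha y)
    obtain ⟨h5, h6⟩ := hmax y δ' B' h1 h2 h3
    rw [← h4, h6.image_eq]
    exact image_mono h5
  have heq : ∀ y, ∀ z ∈ γ y '' A y, γ y '' A y = γ z '' A z := fun y z hz ↦
    have h1 := hsub (hγ y) z hz
    h1.antisymm (hsub (hγ z) y (h1 (hself y)))
  refine ⟨range fun y ↦ γ y '' A y, ⟨?_, fun y ↦ ⟨γ y '' A y, ⟨⟨y, rfl⟩, hself y⟩, ?_⟩⟩, ?_⟩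
  · rintro ⟨y, hy⟩
    exact notMem_empty y (hy ▸ hself y)
  · rintro _ ⟨⟨z, rfl⟩, hz⟩
    exact heq z y hz
  · rintro _ ⟨y, rfl⟩
    exact ⟨γ y, A y, hγ y, rfl⟩

end LineFieldLeaves

section Immersions

/-- The derivative of an immersion is injective. -/
theorem Manifold.IsImmersionAt.mfderiv_injective
    {E : Type*} [NormedAddCommGroup E] [NormedSpace ℝ E] {H : Type*} [TopologicalSpace H]
    {I : ModelWithCorners ℝ E H} [I.Boundaryless]
    {M : Type*} [TopologicalSpace M] [ChartedSpace H M]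
    {E' : Type*} [NormedAddCommGroup E'] [NormedSpace ℝ E'] {H' : Type*} [TopologicalSpace H']
    {I' : ModelWithCorners ℝ E' H'}
    {M' : Type*} [TopologicalSpace M'] [ChartedSpace H' M'] {n : ℕ∞ω} (hn : n ≠ 0)
    {f : M → M'} {x : M}
    (h : Manifold.IsImmersionAt I I' n f x) : Function.Injective (mfderiv I I' f x) := by
  have h1 : ContMDiffAt I' 𝓘(ℝ, E') n (h.codChart.extend I') (f x) :=
    h.codChart.contMDiffAt_extend h.codChart_mem_maximalAtlas h.mem_codChart_source
  have h2 : ContMDiffAt 𝓘(ℝ, E) I n (h.domChart.extend I).symm (h.domChart.extend I x) := by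
    have := contMDiffOn_extend_symm h.domChart_mem_maximalAtlas
    refine this.contMDiffAt ((I.toHomeomorph.isOpenMap _ h.domChart.open_target).mem_nhds ?_)
    exact ⟨_, h.domChart.map_source h.mem_domChart_source, rfl⟩
  set L : E' →L[ℝ] E := ContinuousLinearMap.fst ℝ E h.complement ∘L h.equiv.symm with hL
  have key : ∀ y ∈ h.domChart.source,
      L (h.codChart.extend I' (f y)) = h.domChart.extend I y := by
    intro y hy
    have h3 : y ∈ (h.domChart.extend I).source := by rwa [OpenPartialHomeomorph.extend_source]
    have h4 := h.writtenInCharts ((h.domChart.extend I).map_source h3)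
    simp only [Function.comp_apply, (h.domChart.extend I).left_inv h3] at h4
    rw [h4]
    simp [hL]
  have h5 : ContMDiffAt I' I n ((h.domChart.extend I).symm ∘ L ∘ h.codChart.extend I') (f x) := by
    refine ContMDiffAt.comp (I' := 𝓘(ℝ, E)) (f x) ?_ ?_
    · rw [Function.comp_apply, key x h.mem_domChart_source]
      exact h2
    · exact L.contMDiff.contMDiffAt.comp (f x) h1
  have h6 : ((h.domChart.extend I).symm ∘ L ∘ h.codChart.extend I') ∘ f =ᶠ[𝓝 x] id := by
    filter_upwards [h.domChart.open_source.mem_nhds h.mem_domChart_source] with y hy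
    simp only [Function.comp_apply, key y hy, id]
    exact (h.domChart.extend I).left_inv (by rwa [OpenPartialHomeomorph.extend_source])
  have h7 := (HasMFDerivAt.comp x (h5.mdifferentiableAt hn).hasMFDerivAt
    (h.contMDiffAt.mdifferentiableAt hn).hasMFDerivAt).congr_of_eventuallyEq h6.symm
  have h8 := hasMFDerivAt_unique h7 (hasMFDerivAt_id x)
  exact Function.LeftInverse.injective (g := mfderiv I' I _ (f x)) fun v ↦
    congrArg (fun L : E →L[ℝ] E ↦ L v) h8

end Immersions

section SectionsAlong

variable {B : Type*} {F₁ : Type*} [NormedAddCommGroup F₁] [NormedSpace ℝ F₁]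
  {V : B → Type*} [∀ b, TopologicalSpace (V b)]
  [TopologicalSpace (TotalSpace F₁ V)] {EB : Type*} [NormedAddCommGroup EB] [NormedSpace ℝ EB]
  {HB : Type*} [TopologicalSpace HB] {IB : ModelWithCorners ℝ EB HB} [TopologicalSpace B]
  [ChartedSpace HB B] [FiberBundle F₁ V]
  {F : Type*} [NormedAddCommGroup F] [NormedSpace ℝ F]
  {G : Type*} [TopologicalSpace G] {J : ModelWithCorners ℝ F G}
  {N : Type*} [TopologicalSpace N] [ChartedSpace G N]
  {n : ℕ∞ω} {b : N → B} {v w : (y : N) → V (b y)} {y₀ : N}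

theorem ContMDiffAt.eventually_mem_baseSet
    (hv : ContMDiffAt J (IB.prod 𝓘(ℝ, F₁)) n (fun y ↦ (⟨b y, v y⟩ : TotalSpace F₁ V)) y₀) :
    ∀ᶠ y in 𝓝 y₀, b y ∈ (trivializationAt F₁ V (b y₀)).baseSet :=
  (contMDiffAt_totalSpace.1 hv).1.continuousAt.eventually
    ((trivializationAt F₁ V (b y₀)).open_baseSet.mem_nhds (mem_baseSet_trivializationAt F₁ V _))

variable [∀ b, AddCommGroup (V b)] [∀ b, Module ℝ (V b)] [VectorBundle ℝ F₁ V]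

/-- The product of a `C^n` function and a `C^n` section along a map is `C^n`. -/
theorem ContMDiffAt.smul_along {f : N → ℝ} (hf : ContMDiffAt J 𝓘(ℝ) n f y₀)
    (hv : ContMDiffAt J (IB.prod 𝓘(ℝ, F₁)) n (fun y ↦ (⟨b y, v y⟩ : TotalSpace F₁ V)) y₀) :
    ContMDiffAt J (IB.prod 𝓘(ℝ, F₁)) n (fun y ↦ (⟨b y, f y • v y⟩ : TotalSpace F₁ V)) y₀ := by
  have h := hv.eventually_mem_baseSet
  rw [contMDiffAt_totalSpace] at hv ⊢
  refine ⟨hv.1, (hf.smul hv.2).congr_of_eventuallyEq ?_⟩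
  filter_upwards [h] with y hy
  exact ((trivializationAt F₁ V (b y₀)).linear ℝ hy).map_smul _ _

/-- The difference of two `C^n` sections along a map is `C^n`. -/
theorem ContMDiffAt.sub_along
    (hv : ContMDiffAt J (IB.prod 𝓘(ℝ, F₁)) n (fun y ↦ (⟨b y, v y⟩ : TotalSpace F₁ V)) y₀)
    (hw : ContMDiffAt J (IB.prod 𝓘(ℝ, F₁)) n (fun y ↦ (⟨b y, w y⟩ : TotalSpace F₁ V)) y₀) :
    ContMDiffAt J (IB.prod 𝓘(ℝ, F₁)) n (fun y ↦ (⟨b y, v y - w y⟩ : TotalSpace F₁ V)) y₀ := by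
  have h := hv.eventually_mem_baseSet
  rw [contMDiffAt_totalSpace] at hv hw ⊢
  refine ⟨hv.1, (hv.2.sub hw.2).congr_of_eventuallyEq ?_⟩
  filter_upwards [h] with y hy
  exact ((trivializationAt F₁ V (b y₀)).linear ℝ hy).map_sub _ _

end SectionsAlong

section Transversal

variable {E : Type*} [NormedAddCommGroup E] [NormedSpace ℝ E] [FiniteDimensional ℝ E]
  {H : Type*} [TopologicalSpace H] {I : ModelWithCorners ℝ E H}
  {M : Type*} [TopologicalSpace M] [ChartedSpace H M] [IsManifold I 1 M]
  {F : Type*} [NormedAddCommGroup F] [NormedSpace ℝ F] [FiniteDimensional ℝ F]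
  {G : Type*} [TopologicalSpace G] {J : ModelWithCorners ℝ F G}
  {N : Type*} [TopologicalSpace N] [ChartedSpace G N] [IsManifold J 1 N]

/-- Near a point, the tangent spaces of an immersed hypersurface are the kernels of a `C¹` family
of covectors, and `C¹` tangential vector fields along the hypersurface lift to `C¹` vector fields
on the hypersurface. -/
theorem exists_transversal_covector {ι : N → M} {y₀ : N} (hι : ContMDiffAt J I 2 ι y₀)
    (hinj : Function.Injective (mfderiv J I ι y₀))
    (hdim : Module.finrank ℝ E = Module.finrank ℝ F + 1) {ζ : TangentSpace I (ι y₀)}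
    (hζ : ∀ a, mfderiv J I ι y₀ a ≠ ζ) :
    ∃ (l : (y : N) → TangentSpace I (ι y) →L[ℝ] ℝ)
      (κ : (y : N) → TangentSpace I (ι y) →L[ℝ] TangentSpace J y),
      (∀ᶠ y in 𝓝 y₀, (∀ a, l y (mfderiv J I ι y a) = 0) ∧
        ∀ v, l y v = 0 → mfderiv J I ι y (κ y v) = v) ∧
      ∀ W : (y : N) → TangentSpace I (ι y),
        ContMDiffAt J I.tangent 1 (fun y ↦ (⟨ι y, W y⟩ : TangentBundle I M)) y₀ →
        ContMDiffAt J 𝓘(ℝ) 1 (fun y ↦ l y (W y)) y₀ ∧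
        ContMDiffAt J J.tangent 1 (fun y ↦ (⟨y, κ y (W y)⟩ : TangentBundle J N)) y₀ := by
  set eM := trivializationAt E (TangentSpace I) (ι y₀)
  set eN := trivializationAt F (TangentSpace J) y₀
  have hM : ∀ᶠ y in 𝓝 y₀, ι y ∈ eM.baseSet := hι.continuousAt.eventually
    (eM.open_baseSet.mem_nhds (mem_baseSet_trivializationAt E (TangentSpace I) _))
  have hN : ∀ᶠ y in 𝓝 y₀, y ∈ eN.baseSet :=
    eN.open_baseSet.mem_nhds (mem_baseSet_trivializationAt F (TangentSpace J) _)
  set D : N → F →L[ℝ] E := inTangentCoordinates J I id ι (mfderiv J I ι) y₀ with hD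
  have hD1 : ContMDiffAt J 𝓘(ℝ, F →L[ℝ] E) 1 D y₀ := hι.mfderiv_const (by norm_num)
  have hDa : ∀ y, ι y ∈ eM.baseSet → y ∈ eN.baseSet → ∀ a,
      D y a = eM.continuousLinearMapAt ℝ (ι y) (mfderiv J I ι y (eN.symmL ℝ y a)) :=
    fun y h1 h2 a ↦ rfl
  set ζ' : E := eM.continuousLinearMapAt ℝ (ι y₀) ζ
  set A : N → F × ℝ →L[ℝ] E := fun y ↦ D y ∘L ContinuousLinearMap.fst ℝ F ℝ +
    ContinuousLinearMap.toSpanSingleton ℝ ζ' ∘L ContinuousLinearMap.snd ℝ F ℝ with hA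
  have hAa : ∀ y p, A y p = D y p.1 + p.2 • ζ' := fun y p ↦ rfl
  have hA1 : ContMDiffAt J 𝓘(ℝ, F × ℝ →L[ℝ] E) 1 A y₀ :=
    (hD1.clm_comp contMDiffAt_const).add contMDiffAt_const
  have hM0 := hM.self_of_nhds
  have hN0 := hN.self_of_nhds
  have hAinj : Function.Injective (A y₀) := by
    rw [injective_iff_map_eq_zero]
    rintro ⟨a, t⟩ h
    have h' : eM.continuousLinearMapAt ℝ (ι y₀)
        (mfderiv J I ι y₀ (eN.symmL ℝ y₀ a) + t • ζ) = 0 := by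
      rw [map_add, map_smul]
      exact h
    have h1 : mfderiv J I ι y₀ (eN.symmL ℝ y₀ a) + t • ζ = 0 := by
      rw [← eM.symmL_continuousLinearMapAt (R := ℝ) hM0 (_ + _), h', map_zero]
    have ht : t = 0 := by
      by_contra ht
      refine hζ (-t⁻¹ • eN.symmL ℝ y₀ a) ?_
      rw [map_smul, eq_neg_of_add_eq_zero_left h1, smul_neg, neg_smul, neg_neg, smul_smul,
        inv_mul_cancel₀ ht, one_smul]
    subst ht
    rw [zero_smul, add_zero] at h1
    have h2 := (injective_iff_map_eq_zero _).1 hinj _ h1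
    have h3 : a = 0 := by
      rw [← eN.continuousLinearMapAt_symmL (R := ℝ) hN0 a, h2, map_zero]
    rw [h3]; rfl
  set e₀ : (F × ℝ) ≃L[ℝ] E := (LinearEquiv.ofInjectiveOfFinrankEq (A y₀).toLinearMap hAinj
    (by simp [hdim])).toContinuousLinearEquiv with he₀
  have hAe : A y₀ = e₀ := by ext p <;> rfl
  have hBd : ContMDiffAt J 𝓘(ℝ, E →L[ℝ] F × ℝ) 1 (fun y ↦ (A y).inverse) y₀ := by
    have := contDiffAt_map_inverse (n := 1) e₀
    rw [← hAe] at this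
    exact this.contMDiffAt.comp y₀ hA1
  have hinv : ∀ᶠ y in 𝓝 y₀, ∃ e : (F × ℝ) ≃L[ℝ] E, (e : F × ℝ →L[ℝ] E) = A y := by
    have := e₀.nhds
    rw [← hAe] at this
    exact hA1.continuousAt.eventually this
  set Q : (y : N) → TangentSpace I (ι y) →L[ℝ] F × ℝ := fun y ↦
    (A y).inverse ∘L eM.continuousLinearMapAt ℝ (ι y) with hQ
  refine ⟨fun y ↦ ContinuousLinearMap.snd ℝ F ℝ ∘L Q y,
    fun y ↦ eN.symmL ℝ y ∘L ContinuousLinearMap.fst ℝ F ℝ ∘L Q y, ?_, fun W hW ↦ ?_⟩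
  · filter_upwards [hM, hN, hinv] with y h1 h2 ⟨e, he⟩
    have hQe : ∀ v, Q y v = e.symm (eM.continuousLinearMapAt ℝ (ι y) v) := fun v ↦ by
      simp only [hQ, ← he, ContinuousLinearMap.inverse_equiv]
      rfl
    have hee : ∀ p, e p = D y p.1 + p.2 • ζ' := fun p ↦ by
      rw [← hAa, ← he]; rfl
    refine ⟨fun a ↦ ?_, fun v hv ↦ ?_⟩
    · have : Q y (mfderiv J I ι y a) = (eN.continuousLinearMapAt ℝ y a, 0) := by
        rw [hQe, ContinuousLinearEquiv.symm_apply_eq, hee, hDa y h1 h2,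
          eN.symmL_continuousLinearMapAt h2]
        simp
      change (Q y (mfderiv J I ι y a)).2 = 0
      rw [this]
    · have h3 : e (Q y v) = eM.continuousLinearMapAt ℝ (ι y) v := by
        rw [hQe, ContinuousLinearEquiv.apply_symm_apply]
      have h4 : (Q y v).2 = 0 := hv
      rw [hee, h4, zero_smul, add_zero, hDa y h1 h2] at h3
      have h5 := congrArg (eM.symmL ℝ (ι y)) h3
      rwa [eM.symmL_continuousLinearMapAt h1, eM.symmL_continuousLinearMapAt h1] at h5
  · have hWt := (contMDiffAt_totalSpace.1 hW).2
    have hQ1 : ContMDiffAt J 𝓘(ℝ, F × ℝ) 1 (fun y ↦ Q y (W y)) y₀ := by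
      refine (hBd.clm_apply hWt).congr_of_eventuallyEq ?_
      filter_upwards [hM] with y hy
      simp only [hQ, ContinuousLinearMap.comp_apply,
        eM.continuousLinearMapAt_apply_of_mem ℝ hy]
      rfl
    refine ⟨(ContinuousLinearMap.snd ℝ F ℝ).contMDiff.contMDiffAt.comp y₀ hQ1,
      (contMDiffAt_section y₀).2 ?_⟩
    refine ((ContinuousLinearMap.fst ℝ F ℝ).contMDiff.contMDiffAt.comp y₀
      hQ1).congr_of_eventuallyEq ?_
    filter_upwards [hN] with y hy
    change (eN ⟨y, eN.symmL ℝ y (Q y (W y)).1⟩).2 = (Q y (W y)).1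
    rw [← eN.continuousLinearMapAt_apply_of_mem ℝ hy, eN.continuousLinearMapAt_symmL hy]

end Transversal

section MetricAlong

variable {E : Type*} [NormedAddCommGroup E] [NormedSpace ℝ E]
  {H : Type*} [TopologicalSpace H] {I : ModelWithCorners ℝ E H}
  {M : Type*} [TopologicalSpace M] [ChartedSpace H M]

theorem mdifferentiableAt_extend_comp [IsManifold I 1 M] {c : ℝ → M} {t : ℝ}
    (hc : MDifferentiableAt 𝓘(ℝ) I c t)
    (v : TangentSpace I (c t)) : MDifferentiableAt 𝓘(ℝ) I.tangent
      (fun s ↦ (⟨c s, FiberBundle.extend E v (c s)⟩ : TangentBundle I M)) t :=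
  MDifferentiableAt.comp (g := fun x ↦ (⟨x, FiberBundle.extend E v x⟩ : TangentBundle I M)) t
    (FiberBundle.mdifferentiableAt_extend I E v) hc

variable [FiniteDimensional ℝ E] [IsManifold I ∞ M]
  [RiemannianBundle (fun x : M ↦ TangentSpace I x)]
  [IsContMDiffRiemannianBundle I ∞ E (fun x : M ↦ TangentSpace I x)]

/-- The derivative of the inner product of a vector field along a curve with a vector field along
the curve that vanishes at a point. -/
theorem hasDerivAt_inner_sub_extend {c : ℝ → M} {t : ℝ} (hc : MDifferentiableAt 𝓘(ℝ) I c t)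
    {W Z : (s : ℝ) → TangentSpace I (c s)} {d : E}
    (hW : HasDerivAt (fun s ↦ (trivializationAt E (TangentSpace I) (c t)
      (⟨c s, W s⟩ : TangentBundle I M)).2) d t)
    (hZ : MDifferentiableAt 𝓘(ℝ) I.tangent (fun s ↦ (⟨c s, Z s⟩ : TangentBundle I M)) t) :
    HasDerivAt (fun s ↦ ⟪W s - FiberBundle.extend E (W t) (c s), Z s⟫_ℝ)
      ⟪(trivializationAt E (TangentSpace I) (c t)).symmL ℝ (c t) d, Z t⟫_ℝ t := by
  set e := trivializationAt E (TangentSpace I) (c t)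
  set w : ℝ → E := fun s ↦ (e ⟨c s, W s⟩).2 with hw
  have hbase : ∀ᶠ s in 𝓝 t, c s ∈ e.baseSet := hc.continuousAt.eventually
    (e.open_baseSet.mem_nhds (mem_baseSet_trivializationAt E (TangentSpace I) _))
  have hbt := hbase.self_of_nhds
  set b := Module.finBasis ℝ E
  set X : (i : Fin (Module.finrank ℝ E)) → (s : ℝ) → TangentSpace I (c s) :=
    fun i s ↦ e.symmL ℝ (c s) (b i) with hX
  have hXe : ∀ i s, c s ∈ e.baseSet →
      FiberBundle.extend E (e.symmL ℝ (c t) (b i)) (c s) = X i s := by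
    intro i s hs
    simp only [FiberBundle.extend, hX]
    rw [e.symmL_apply hs, ← e.continuousLinearMapAt_apply_of_mem ℝ hbt,
      e.continuousLinearMapAt_symmL hbt]
  have hXd : ∀ i, DifferentiableAt ℝ (fun s ↦ ⟪X i s, Z s⟫_ℝ) t := by
    intro i
    have h1 := MDifferentiableAt.inner_bundle (F := E) (E := fun x : M ↦ TangentSpace I x)
      (mdifferentiableAt_extend_comp hc (e.symmL ℝ (c t) (b i))) hZ
    refine (mdifferentiableAt_iff_differentiableAt.1 h1).congr_of_eventuallyEq ?_
    filter_upwards [hbase] with s hs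
    rw [hXe i s hs]
  have hexp : ∀ s (v : E), e.symmL ℝ (c s) v = ∑ i, b.repr v i • X i s := by
    intro s v
    conv_lhs => rw [← b.sum_repr v]
    rw [map_sum]
    exact Finset.sum_congr rfl fun i _ ↦ map_smul _ _ _
  have hsum : (fun s ↦ ⟪W s - FiberBundle.extend E (W t) (c s), Z s⟫_ℝ) =ᶠ[𝓝 t]
      fun s ↦ ∑ i, b.repr (w s - w t) i * ⟪X i s, Z s⟫_ℝ := by
    filter_upwards [hbase] with s hs
    have h1 : W s - FiberBundle.extend E (W t) (c s) = e.symmL ℝ (c s) (w s - w t) := by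
      rw [map_sub, hw]
      simp only [FiberBundle.extend]
      rw [← e.continuousLinearMapAt_apply_of_mem ℝ hs, e.symmL_continuousLinearMapAt hs,
        e.symmL_apply hs]
    rw [h1, hexp, sum_inner]
    exact Finset.sum_congr rfl fun i _ ↦ real_inner_smul_left _ _ _
  refine HasDerivAt.congr_of_eventuallyEq ?_ hsum
  rw [hexp, sum_inner]
  refine HasDerivAt.fun_sum fun i _ ↦ ?_
  have h1 : HasDerivAt (fun s ↦ b.repr (w s - w t) i) (b.repr d i) t :=
    ((b.coord i).toContinuousLinearMap.hasFDerivAt.comp_hasDerivAt t (hW.sub_const (w t)))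
  have h2 := h1.mul (hXd i).hasDerivAt
  simp only [sub_self, map_zero, Finsupp.coe_zero, Pi.zero_apply, zero_mul, add_zero] at h2
  rw [real_inner_smul_left]
  exact h2

/-- Metric connections: the product rule for the inner product of vector fields along a curve. -/
theorem hasDerivAt_inner_along {cov : CovariantDerivative I E (fun x : M ↦ TangentSpace I x)}
    (hcov : ∀ (x : M) (Y Z : (x : M) → TangentSpace I x),
      MDifferentiableAt I I.tangent (fun x ↦ (⟨x, Y x⟩ : TangentBundle I M)) x →
      MDifferentiableAt I I.tangent (fun x ↦ (⟨x, Z x⟩ : TangentBundle I M)) x →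
      ∀ v : TangentSpace I x, mfderiv I 𝓘(ℝ) (fun x ↦ ⟪Y x, Z x⟫_ℝ) x v
        = ⟪cov Y x v, Z x⟫_ℝ + ⟪Y x, cov Z x v⟫_ℝ)
    {c : ℝ → M} {t : ℝ} {W Z : (s : ℝ) → TangentSpace I (c s)}
    (hW : MDifferentiableAt 𝓘(ℝ) I.tangent (fun s ↦ (⟨c s, W s⟩ : TangentBundle I M)) t)
    (hZ : MDifferentiableAt 𝓘(ℝ) I.tangent (fun s ↦ (⟨c s, Z s⟩ : TangentBundle I M)) t) :
    HasDerivAt (fun s ↦ ⟪W s, Z s⟫_ℝ)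
      (⟪covDerivAlong 𝓘(ℝ) cov c W t (1 : ℝ), Z t⟫_ℝ +
        ⟪W t, covDerivAlong 𝓘(ℝ) cov c Z t (1 : ℝ)⟫_ℝ) t := by
  have hc : MDifferentiableAt 𝓘(ℝ) I c t := ((mdifferentiableAt_totalSpace _ _).1 hW).1
  have hd : ∀ {W : (s : ℝ) → TangentSpace I (c s)},
      MDifferentiableAt 𝓘(ℝ) I.tangent (fun s ↦ (⟨c s, W s⟩ : TangentBundle I M)) t →
      HasDerivAt (fun s ↦ (trivializationAt E (TangentSpace I) (c t)
        (⟨c s, W s⟩ : TangentBundle I M)).2)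
        (mfderiv 𝓘(ℝ) 𝓘(ℝ, E) (fun s ↦ (trivializationAt E (TangentSpace I) (c t)
          (⟨c s, W s⟩ : TangentBundle I M)).2) t (1 : ℝ)) t := by
    intro W hW
    rw [mfderiv_eq_fderiv]
    exact (mdifferentiableAt_iff_differentiableAt.1
      ((mdifferentiableAt_totalSpace _ _).1 hW).2).hasFDerivAt.hasDerivAt
  have h1 := hasDerivAt_inner_sub_extend hc (hd hW) hZ
  have h2 := hasDerivAt_inner_sub_extend hc (hd hZ) (mdifferentiableAt_extend_comp hc (W t))
  have hX1 : MDifferentiableAt I I.tangent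
    (fun x ↦ (⟨x, FiberBundle.extend E (W t) x⟩ : TangentBundle I M)) (c t) :=
    FiberBundle.mdifferentiableAt_extend I E (W t)
  have hX2 : MDifferentiableAt I I.tangent
    (fun x ↦ (⟨x, FiberBundle.extend E (Z t) x⟩ : TangentBundle I M)) (c t) :=
    FiberBundle.mdifferentiableAt_extend I E (Z t)
  have h3 : HasDerivAt (fun s ↦ ⟪FiberBundle.extend E (W t) (c s),
      FiberBundle.extend E (Z t) (c s)⟫_ℝ)
      (mfderiv I 𝓘(ℝ) (fun x ↦ ⟪FiberBundle.extend E (W t) x, FiberBundle.extend E (Z t) x⟫_ℝ)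
        (c t) (mfderiv 𝓘(ℝ) I c t (1 : ℝ))) t := by
    have h4 : MDifferentiableAt I 𝓘(ℝ) (fun x ↦ ⟪FiberBundle.extend E (W t) x,
        FiberBundle.extend E (Z t) x⟫_ℝ) (c t) :=
      MDifferentiableAt.inner_bundle (F := E) (E := fun x : M ↦ TangentSpace I x)
        (b := fun x ↦ x) (v := fun x ↦ FiberBundle.extend E (W t) x)
        (w := fun x ↦ FiberBundle.extend E (Z t) x) hX1 hX2
    have h6 := HasMFDerivAt.comp t h4.hasMFDerivAt hc.hasMFDerivAt
    exact (show HasFDerivAt (𝕜 := ℝ) (E := ℝ) (F := ℝ) _ _ t from h6.hasFDerivAt).hasDerivAt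
  rw [hcov _ _ _ hX1 hX2] at h3
  have h5 := (h1.add h2).add h3
  have hfun : (fun s ↦ ⟪W s, Z s⟫_ℝ) =
      (((fun s ↦ ⟪W s - FiberBundle.extend E (W t) (c s), Z s⟫_ℝ) +
        fun s ↦ ⟪Z s - FiberBundle.extend E (Z t) (c s), FiberBundle.extend E (W t) (c s)⟫_ℝ) +
      fun s ↦ ⟪FiberBundle.extend E (W t) (c s), FiberBundle.extend E (Z t) (c s)⟫_ℝ) := by
    funext s
    simp only [Pi.add_apply, inner_sub_left]
    rw [real_inner_comm (FiberBundle.extend E (W t) (c s)) (Z s),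
      real_inner_comm (FiberBundle.extend E (W t) (c s)) (FiberBundle.extend E (Z t) (c s))]
    ring
  rw [hfun]
  refine h5.congr_deriv ?_
  simp only [FiberBundle.extend_apply_self]
  have hdef : ∀ W : (s : ℝ) → TangentSpace I (c s), covDerivAlong 𝓘(ℝ) cov c W t (1 : ℝ) =
      (trivializationAt E (TangentSpace I) (c t)).symmL ℝ (c t)
        (mfderiv 𝓘(ℝ) 𝓘(ℝ, E) (fun s ↦ (trivializationAt E (TangentSpace I) (c t)
          (⟨c s, W s⟩ : TangentBundle I M)).2) t (1 : ℝ)) +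
      cov (FiberBundle.extend E (W t)) (c t) (mfderiv 𝓘(ℝ) I c t (1 : ℝ)) := fun _ ↦ rfl
  rw [hdef, hdef, inner_add_left, inner_add_right]
  exact (add_add_add_comm _ _ _ _).trans
    (congrArg₂ (· + ·) rfl (congrArg₂ (· + ·) (real_inner_comm _ _) rfl))

end MetricAlong

section PlaneGeometry

variable {X : Type*} [NormedAddCommGroup X] [InnerProductSpace ℝ X]

/-- In a plane, a vector orthogonal to two nonzero orthogonal vectors vanishes. -/
theorem Submodule.eq_zero_of_inner_eq_zero {W : Submodule ℝ X} (hW : Module.finrank ℝ W = 2)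
    {a b z : X} (ha : a ∈ W) (hb : b ∈ W) (hz : z ∈ W) (ha0 : a ≠ 0) (hb0 : b ≠ 0)
    (hab : ⟪a, b⟫_ℝ = 0) (haz : ⟪a, z⟫_ℝ = 0) (hbz : ⟪b, z⟫_ℝ = 0) : z = 0 := by
  by_contra hz0
  have hli : LinearIndependent ℝ ![(⟨a, ha⟩ : W), ⟨b, hb⟩, ⟨z, hz⟩] := by
    refine linearIndependent_of_ne_zero_of_inner_eq_zero (𝕜 := ℝ) ?_ ?_
    · intro i
      fin_cases i <;> simpa [Subtype.ext_iff]
    · intro i j hij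
      fin_cases i <;> fin_cases j <;>
        simp_all [real_inner_comm]
  have : FiniteDimensional ℝ W := Module.finite_of_finrank_eq_succ hW
  have := hli.fintype_card_le_finrank
  simp [hW] at this

/-- Two unit vectors of a plane that are orthogonal to a third one are equal or opposite. -/
theorem Submodule.eq_or_eq_neg_of_inner_eq_zero {W : Submodule ℝ X}
    (hW : Module.finrank ℝ W = 2) {a b c : X} (ha : a ∈ W) (hb : b ∈ W) (hc : c ∈ W)
    (ha1 : ‖a‖ = 1) (hb1 : ‖b‖ = 1) (hc0 : c ≠ 0) (hac : ⟪a, c⟫_ℝ = 0) (hbc : ⟪b, c⟫_ℝ = 0) :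
    a = b ∨ a = -b := by
  have haa : ⟪a, a⟫_ℝ = 1 := by rw [real_inner_self_eq_norm_sq, ha1, one_pow]
  have h : b - ⟪a, b⟫_ℝ • a = 0 := by
    refine Submodule.eq_zero_of_inner_eq_zero hW ha hc (W.sub_mem hb (W.smul_mem _ ha)) ?_ hc0
      hac ?_ ?_
    · rintro rfl
      simp at ha1
    · rw [inner_sub_right, real_inner_smul_right, haa, mul_one, sub_self]
    · rw [inner_sub_right, real_inner_smul_right, real_inner_comm, hbc, real_inner_comm a c,
        hac, mul_zero, sub_zero]
  rw [sub_eq_zero] at h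
  have hn : |⟪a, b⟫_ℝ| = 1 := by
    have := congrArg norm h
    rwa [norm_smul, ha1, hb1, mul_one, Real.norm_eq_abs, eq_comm] at this
  rcases eq_or_eq_neg_of_abs_eq hn with h1 | h1
  · left; rw [h, h1, one_smul]
  · right; rw [h, h1, neg_one_smul, neg_neg]

/-- The combination of two vectors with the exchanged components of `w` is orthogonal to `w`. -/
theorem inner_rotate_eq_zero (s₀ s₁ w : X) :
    ⟪⟪s₁, w⟫_ℝ • s₀ - ⟪s₀, w⟫_ℝ • s₁, w⟫_ℝ = 0 := by
  rw [inner_sub_left, real_inner_smul_left, real_inner_smul_left]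
  ring

end PlaneGeometry

section HorizontalPart

variable {E : Type*} [NormedAddCommGroup E] [NormedSpace ℝ E]
  {H : Type*} [TopologicalSpace H] {I : ModelWithCorners ℝ E H}
  {M : Type*} [TopologicalSpace M] [ChartedSpace H M] [IsManifold I ∞ M]
  {k m : ℕ}

theorem SubRiemannianStructure.finrank_eq (S : SubRiemannianStructure I M k) (x : M) :
    Module.finrank ℝ (S.V₀ x) = k + 1 := by
  obtain ⟨u, -, hx, s, -, h⟩ := S.exists_frame x
  obtain ⟨h1, h2⟩ := h x hx
  rw [← h2, finrank_span_eq_card h1, Fintype.card_fin]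

variable [RiemannianBundle (fun x : M ↦ TangentSpace I x)]
  {S : SubRiemannianStructure I M k} (R : VerticallyRigidComplement S m)

namespace VerticallyRigidComplement

theorem inner_frame_horizontalPart {x : M} (v : TangentSpace I x) (i : Fin m) :
    ⟪R.T i x, R.horizontalPart v⟫_ℝ = 0 := by
  rw [horizontalPart, inner_sub_right, (R.T_orthonormal x).inner_right_fintype, sub_self]

theorem inner_horizontalPart {x : M} {v w : TangentSpace I x} (hw : w ∈ S.V₀ x) :
    ⟪R.horizontalPart v, w⟫_ℝ = ⟪v, w⟫_ℝ := by
  rw [horizontalPart, inner_sub_left, sum_inner, Finset.sum_eq_zero, sub_zero]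
  intro i _
  rw [real_inner_smul_left, real_inner_comm w, R.orthogonal x w hw i, mul_zero]

theorem horizontalPart_mem {x : M} (v : TangentSpace I x) : R.horizontalPart v ∈ S.V₀ x := by
  have h1 : R.horizontalPart v ∈ S.V₀ x ⊔ Submodule.span ℝ (Set.range fun i ↦ R.T i x) := by
    rw [(R.isCompl x).sup_eq_top]; trivial
  obtain ⟨a, ha, b, hb, hab⟩ := Submodule.mem_sup.1 h1
  have h2 : ∀ i, ⟪R.T i x, b⟫_ℝ = 0 := by
    intro i
    have h3 := R.inner_frame_horizontalPart v i
    rwa [← hab, inner_add_right, real_inner_comm, R.orthogonal x a ha i, zero_add] at h3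
  have h4 : ⟪b, b⟫_ℝ = 0 := by
    refine Submodule.span_induction (p := fun c _ ↦ ⟪c, b⟫_ℝ = 0) ?_ ?_ ?_ ?_ hb
    · rintro _ ⟨i, rfl⟩
      exact h2 i
    · exact inner_zero_left _
    · intro c d _ _ hc hd
      rw [inner_add_left, hc, hd, add_zero]
    · intro r c _ hc
      rw [real_inner_smul_left, hc, mul_zero]
  rw [← hab, inner_self_eq_zero.1 h4, add_zero]
  exact ha

end VerticallyRigidComplement

variable {F : Type*} [NormedAddCommGroup F] [NormedSpace ℝ F]
  {G : Type*} [TopologicalSpace G] {J : ModelWithCorners ℝ F G} {N : Type*} {ι : N → M}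
  {νg : (y : N) → TangentSpace I (ι y)}

theorem horizontalNormal_mem (y : N) : horizontalNormal R ι νg y ∈ S.V₀ (ι y) :=
  (S.V₀ (ι y)).smul_mem _ (R.horizontalPart_mem _)

theorem inner_horizontalNormal {y : N} {w : TangentSpace I (ι y)} (hw : w ∈ S.V₀ (ι y)) :
    ⟪horizontalNormal R ι νg y, w⟫_ℝ = ‖R.horizontalPart (νg y)‖⁻¹ * ⟪νg y, w⟫_ℝ := by
  rw [horizontalNormal, real_inner_smul_left, R.inner_horizontalPart hw]

variable [TopologicalSpace N] [ChartedSpace G N] [FiniteDimensional ℝ E]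

/-- The tangent space of a hypersurface is the orthogonal complement of the normal. -/
theorem IsUnitNormal.exists_mfderiv_eq (hνg : IsUnitNormal J ι νg) {y : N}
    (hinj : Function.Injective (mfderiv J I ι y))
    (hdim : Module.finrank ℝ E = Module.finrank ℝ F + 1) {v : TangentSpace I (ι y)}
    (hv : ⟪νg y, v⟫_ℝ = 0) : ∃ a, mfderiv J I ι y a = v := by
  have : FiniteDimensional ℝ (TangentSpace I (ι y)) := inferInstanceAs (FiniteDimensional ℝ E)
  have : Fact (Module.finrank ℝ (TangentSpace I (ι y)) = Module.finrank ℝ F + 1) := ⟨hdim⟩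
  have h0 : νg y ≠ 0 := by
    intro h
    simpa [h] using hνg.norm_eq_one y
  have hle : LinearMap.range (mfderiv J I ι y).toLinearMap ≤ (ℝ ∙ νg y)ᗮ := by
    rintro _ ⟨a, rfl⟩
    exact Submodule.mem_orthogonal_singleton_iff_inner_right.2 (hνg.orthogonal y a)
  have heq := Submodule.eq_of_le_of_finrank_eq hle <| by
    rw [Submodule.finrank_orthogonal_span_singleton (n := Module.finrank ℝ F) h0]
    exact LinearMap.finrank_range_of_inj hinj
  have hmem : v ∈ LinearMap.range (mfderiv J I ι y).toLinearMap := by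
    rw [heq]
    exact Submodule.mem_orthogonal_singleton_iff_inner_right.2 hv
  exact hmem

theorem horizontalPart_ne_zero (hνg : IsUnitNormal J ι νg) {y : N}
    (hinj : Function.Injective (mfderiv J I ι y))
    (hdim : Module.finrank ℝ E = Module.finrank ℝ F + 1)
    (hchar : IsNoncharacteristicAt J S ι y) : R.horizontalPart (νg y) ≠ 0 := by
  intro h
  refine hchar fun v hv ↦ ?_
  refine hνg.exists_mfderiv_eq hinj hdim ?_
  rw [← R.inner_horizontalPart hv, h, inner_zero_left]

theorem norm_horizontalNormal (hνg : IsUnitNormal J ι νg) {y : N}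
    (hinj : Function.Injective (mfderiv J I ι y))
    (hdim : Module.finrank ℝ E = Module.finrank ℝ F + 1)
    (hchar : IsNoncharacteristicAt J S ι y) : ‖horizontalNormal R ι νg y‖ = 1 := by
  rw [horizontalNormal, norm_smul, norm_inv, norm_norm, inv_mul_cancel₀]
  exact norm_ne_zero_iff.2 (horizontalPart_ne_zero R hνg hinj hdim hchar)

end HorizontalPart

section PerpField

variable {E : Type*} [NormedAddCommGroup E] [NormedSpace ℝ E] [FiniteDimensional ℝ E]
  {H : Type*} [TopologicalSpace H] {I : ModelWithCorners ℝ E H}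
  {M : Type*} [TopologicalSpace M] [ChartedSpace H M] [IsManifold I ∞ M]
  [RiemannianBundle (fun x : M ↦ TangentSpace I x)]
  [IsContMDiffRiemannianBundle I ∞ E (fun x : M ↦ TangentSpace I x)]
  {F : Type*} [NormedAddCommGroup F] [NormedSpace ℝ F] [FiniteDimensional ℝ F]
  {G : Type*} [TopologicalSpace G] {J : ModelWithCorners ℝ F G}
  {N : Type*} [TopologicalSpace N] [ChartedSpace G N]
  {m : ℕ} {ι : N → M}

omit [FiniteDimensional ℝ E] [FiniteDimensional ℝ F] in
/-- The normalization of a `C¹` vector field along a map. -/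
theorem ContMDiffAt.normalize_along {W : (y : N) → TangentSpace I (ι y)} {y₀ : N}
    (hW : ContMDiffAt J I.tangent 1 (fun y ↦ (⟨ι y, W y⟩ : TangentBundle I M)) y₀)
    (h0 : W y₀ ≠ 0) :
    ContMDiffAt J I.tangent 1 (fun y ↦ (⟨ι y, ‖W y‖⁻¹ • W y⟩ : TangentBundle I M)) y₀ := by
  have h1 : ContMDiffAt J 𝓘(ℝ) 1 (fun y ↦ ⟪W y, W y⟫_ℝ) y₀ :=
    ContMDiffAt.inner_bundle (F := E) (E := fun x : M ↦ TangentSpace I x) hW hW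
  have h2 : ContDiffAt ℝ 1 (fun r : ℝ ↦ (√r)⁻¹) ⟪W y₀, W y₀⟫_ℝ := by
    have h3 : ⟪W y₀, W y₀⟫_ℝ ≠ 0 := fun h ↦ h0 (inner_self_eq_zero.1 h)
    refine (Real.contDiffAt_sqrt h3).inv ?_
    rw [← norm_eq_sqrt_real_inner]
    exact norm_ne_zero_iff.2 h0
  have h3 := (h2.contMDiffAt.comp y₀ h1).smul_along hW
  simpa only [Function.comp_apply, ← norm_eq_sqrt_real_inner] using h3

variable {S : SubRiemannianStructure I M 1} (R : VerticallyRigidComplement S m)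
  {νg : (y : N) → TangentSpace I (ι y)}

variable (J ι νg) in
/-- The tangent vectors of a hypersurface that are unit vectors of `ν^⊥`. -/
def IsPerpVector (y : N) (a : TangentSpace J y) : Prop :=
  mfderiv J I ι y a ∈ S.V₀ (ι y) ∧ ‖mfderiv J I ι y a‖ = 1 ∧
    ⟪mfderiv J I ι y a, horizontalNormal R ι νg y⟫_ℝ = 0

/-- Near a point of a noncharacteristic hypersurface there are a `C¹` unit tangent field spanning
the characteristic direction and a `C¹` horizontal unit field orthogonal to it. -/
theorem exists_local_adapted_frame [IsManifold J 1 N] (hι : ContMDiff J I 2 ι)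
    (hinj : ∀ y, Function.Injective (mfderiv J I ι y))
    (hdim : Module.finrank ℝ E = Module.finrank ℝ F + 1)
    (hνg : IsUnitNormal J ι νg) (hchar : ∀ y, IsNoncharacteristicAt J S ι y) (y₀ : N) :
    ∃ (U : (y : N) → TangentSpace J y) (ν : (y : N) → TangentSpace I (ι y)),
      ContMDiffAt J J.tangent 1 (fun y ↦ (⟨y, U y⟩ : TangentBundle J N)) y₀ ∧
      ContMDiffAt J I.tangent 1 (fun y ↦ (⟨ι y, ν y⟩ : TangentBundle I M)) y₀ ∧
      ∀ᶠ y in 𝓝 y₀, IsPerpVector J ι R νg y (U y) ∧ ν y ∈ S.V₀ (ι y) ∧ ‖ν y‖ = 1 ∧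
        ⟪ν y, mfderiv J I ι y (U y)⟫_ℝ = 0 := by
  have hζ : ∀ a, mfderiv J I ι y₀ a ≠ νg y₀ := by
    intro a ha
    have h1 := hνg.orthogonal y₀ a
    rw [ha, real_inner_self_eq_norm_sq, hνg.norm_eq_one y₀] at h1
    norm_num at h1
  obtain ⟨l, κ, hker, hsm⟩ := exists_transversal_covector (hι y₀) (hinj y₀) hdim hζ
  obtain ⟨u, hu, hyu, s, hs, hspan⟩ := S.exists_frame (ι y₀)
  have hsι : ∀ i, ContMDiffAt J I.tangent 1
      (fun y ↦ (⟨ι y, s i (ι y)⟩ : TangentBundle I M)) y₀ := fun i ↦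
    ContMDiffAt.comp (g := fun x ↦ (⟨x, s i x⟩ : TangentBundle I M)) y₀
      (((hs i).contMDiffAt (hu.mem_nhds hyu)).of_le (by norm_num)) ((hι y₀).of_le (by norm_num))
  set w : (y : N) → TangentSpace I (ι y) :=
    fun y ↦ l y (s 1 (ι y)) • s 0 (ι y) - l y (s 0 (ι y)) • s 1 (ι y) with hw
  have hw1 : ContMDiffAt J I.tangent 1 (fun y ↦ (⟨ι y, w y⟩ : TangentBundle I M)) y₀ :=
    ((hsm _ (hsι 1)).1.smul_along (hsι 0)).sub_along ((hsm _ (hsι 0)).1.smul_along (hsι 1))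
  set q : (y : N) → TangentSpace I (ι y) :=
    fun y ↦ ⟪s 1 (ι y), w y⟫_ℝ • s 0 (ι y) - ⟪s 0 (ι y), w y⟫_ℝ • s 1 (ι y) with hq
  have hin : ∀ i, ContMDiffAt J 𝓘(ℝ) 1 (fun y ↦ ⟪s i (ι y), w y⟫_ℝ) y₀ := fun i ↦
    ContMDiffAt.inner_bundle (F := E) (E := fun x : M ↦ TangentSpace I x) (hsι i) hw1
  have hq1 : ContMDiffAt J I.tangent 1 (fun y ↦ (⟨ι y, q y⟩ : TangentBundle I M)) y₀ :=
    ((hin 1).smul_along (hsι 0)).sub_along ((hin 0).smul_along (hsι 1))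
  have hmain : ∀ᶠ y in 𝓝 y₀, (w y ≠ 0 ∧ w y ∈ S.V₀ (ι y) ∧
      ∀ r : ℝ, mfderiv J I ι y (κ y (r • w y)) = r • w y) ∧ q y ≠ 0 ∧ q y ∈ S.V₀ (ι y) := by
    filter_upwards [hker, (hι y₀).continuousAt.eventually (hu.mem_nhds hyu)] with y hy1 hy2
    obtain ⟨hli, hsp⟩ := hspan (ι y) hy2
    have hs2 : ∀ i, s i (ι y) ∈ S.V₀ (ι y) := fun i ↦ by
      rw [← hsp]; exact Submodule.subset_span ⟨i, rfl⟩
    have hpair : ∀ a b : ℝ, a • s 0 (ι y) - b • s 1 (ι y) = 0 → a = 0 ∧ b = 0 := by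
      intro a b hab
      have h1 := Fintype.linearIndependent_iff.1 hli ![a, -b] (by
        simpa [Fin.sum_univ_two, sub_eq_add_neg] using hab)
      exact ⟨by simpa using h1 0, by simpa using h1 1⟩
    have hwV : w y ∈ S.V₀ (ι y) :=
      (S.V₀ (ι y)).sub_mem ((S.V₀ (ι y)).smul_mem _ (hs2 0)) ((S.V₀ (ι y)).smul_mem _ (hs2 1))
    have hw0 : w y ≠ 0 := by
      intro h
      obtain ⟨h1, h0⟩ := hpair _ _ h
      refine hchar y fun v hv ↦ ⟨κ y v, hy1.2 v ?_⟩
      rw [← hsp] at hv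
      refine Submodule.span_induction (p := fun c _ ↦ l y c = 0) ?_ (map_zero _) ?_ ?_ hv
      · rintro _ ⟨i, rfl⟩
        fin_cases i
        exacts [h0, h1]
      · intro c d _ _ hc hd
        rw [map_add, hc, hd, add_zero]
      · intro r c _ hc
        rw [map_smul, hc, smul_zero]
    refine ⟨⟨hw0, hwV, fun r ↦ hy1.2 _ ?_⟩, fun h ↦ hw0 ?_,
      (S.V₀ (ι y)).sub_mem ((S.V₀ (ι y)).smul_mem _ (hs2 0)) ((S.V₀ (ι y)).smul_mem _ (hs2 1))⟩
    · rw [map_smul, hw, map_sub, map_smul, map_smul, smul_eq_mul, smul_eq_mul, smul_eq_mul]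
      ring
    · obtain ⟨h1, h0⟩ := hpair _ _ h
      rw [← inner_self_eq_zero (𝕜 := ℝ)]
      nth_rw 1 [hw]
      rw [inner_sub_left, real_inner_smul_left, real_inner_smul_left, h0, h1]
      ring
  obtain ⟨⟨hw0, -, -⟩, hq0, -⟩ := hmain.self_of_nhds
  refine ⟨fun y ↦ κ y (‖w y‖⁻¹ • w y), fun y ↦ ‖q y‖⁻¹ • q y, (hsm _ (hw1.normalize_along hw0)).2,
    hq1.normalize_along hq0, ?_⟩
  filter_upwards [hmain] with y ⟨⟨h1, h2, h3⟩, h4, h5⟩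
  have h6 : ‖w y‖⁻¹ • w y ∈ S.V₀ (ι y) := (S.V₀ (ι y)).smul_mem _ h2
  rw [IsPerpVector, h3]
  refine ⟨⟨h6, ?_, ?_⟩, (S.V₀ (ι y)).smul_mem _ h5, ?_, ?_⟩
  · rw [norm_smul, norm_inv, norm_norm, inv_mul_cancel₀ (norm_ne_zero_iff.2 h1)]
  · rw [real_inner_comm, inner_horizontalNormal R h6, ← h3, hνg.orthogonal, mul_zero]
  · rw [norm_smul, norm_inv, norm_norm, inv_mul_cancel₀ (norm_ne_zero_iff.2 h4)]
  · rw [real_inner_smul_left, real_inner_smul_right, inner_rotate_eq_zero, mul_zero, mul_zero]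

/-- The characteristic directions of a noncharacteristic hypersurface form a `C¹` line field. -/
theorem isLineField_isPerpVector [IsManifold J 1 N] (hι : ContMDiff J I 2 ι)
    (hinj : ∀ y, Function.Injective (mfderiv J I ι y))
    (hdim : Module.finrank ℝ E = Module.finrank ℝ F + 1)
    (hνg : IsUnitNormal J ι νg) (hchar : ∀ y, IsNoncharacteristicAt J S ι y) :
    IsLineField J (IsPerpVector J ι R νg) where
  neg y a h := by
    refine ⟨?_, ?_, ?_⟩
    · rw [map_neg]; exact (S.V₀ (ι y)).neg_mem h.1
    · rw [map_neg, norm_neg]; exact h.2.1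
    · rw [map_neg, inner_neg_left, h.2.2, neg_zero]
  eq_or_eq_neg y a b ha hb := by
    have h0 : horizontalNormal R ι νg y ≠ 0 := by
      rw [← norm_ne_zero_iff, norm_horizontalNormal R hνg (hinj y) hdim (hchar y)]
      exact one_ne_zero
    rcases Submodule.eq_or_eq_neg_of_inner_eq_zero (S.finrank_eq (ι y)) ha.1 hb.1
      (horizontalNormal_mem R y) ha.2.1 hb.2.1 h0 ha.2.2 hb.2.2 with h | h
    · exact .inl (hinj y h)
    · exact .inr (hinj y (by rw [h, map_neg]))
  ne_zero y a ha h := by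
    have := ha.2.1
    rw [h, map_zero, norm_zero] at this
    exact zero_ne_one this
  exists_local y₀ := by
    obtain ⟨U, ν, hU, -, h⟩ := exists_local_adapted_frame R hι hinj hdim hνg hchar y₀
    exact ⟨U, hU, h.mono fun y hy ↦ hy.1⟩

/-- The horizontal normal of a noncharacteristic `C²` hypersurface is `C¹`. -/
theorem contMDiffAt_horizontalNormal [IsManifold J 1 N] (hι : ContMDiff J I 2 ι)
    (hinj : ∀ y, Function.Injective (mfderiv J I ι y))
    (hdim : Module.finrank ℝ E = Module.finrank ℝ F + 1)
    (hνg : IsUnitNormal J ι νg) (hchar : ∀ y, IsNoncharacteristicAt J S ι y) (y₀ : N) :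
    ContMDiffAt J I.tangent 1
      (fun y ↦ (⟨ι y, horizontalNormal R ι νg y⟩ : TangentBundle I M)) y₀ := by
  obtain ⟨U, ν, -, hν, h⟩ := exists_local_adapted_frame R hι hinj hdim hνg hchar y₀
  have hnorm := fun y ↦ norm_horizontalNormal R hνg (hinj y) hdim (hchar y)
  have hpos : ∀ y, 0 < ‖R.horizontalPart (νg y)‖⁻¹ := fun y ↦
    inv_pos.2 (norm_pos_iff.2 (horizontalPart_ne_zero R hνg (hinj y) hdim (hchar y)))
  have halt : ∀ᶠ y in 𝓝 y₀, (horizontalNormal R ι νg y = ν y ∨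
      horizontalNormal R ι νg y = -ν y) ∧ ν y ∈ S.V₀ (ι y) ∧ ‖ν y‖ = 1 := by
    filter_upwards [h] with y ⟨h1, h2, h3, h4⟩
    refine ⟨Submodule.eq_or_eq_neg_of_inner_eq_zero (S.finrank_eq (ι y))
      (horizontalNormal_mem R y) h2 h1.1 (hnorm y) h3 ?_ ?_ h4, h2, h3⟩
    · rw [← norm_ne_zero_iff, h1.2.1]
      exact one_ne_zero
    · rw [real_inner_comm]
      exact h1.2.2
  have hcont : ContinuousAt (fun y ↦ ⟪νg y, ν y⟫_ℝ) y₀ := by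
    have : IsContinuousRiemannianBundle E (fun x : M ↦ TangentSpace I x) :=
      have ⟨g, hg, hg'⟩ := IsContMDiffRiemannianBundle.exists_contMDiff (IB := I) (n := ∞)
        (F := E) (E := fun x : M ↦ TangentSpace I x)
      ⟨g, hg.continuous, hg'⟩
    exact ContinuousAt.inner_bundle (F := E) (E := fun x : M ↦ TangentSpace I x)
      hνg.continuous.continuousAt hν.continuousAt
  have hinner : ∀ y, ν y ∈ S.V₀ (ι y) → ∀ σ : ℝ, horizontalNormal R ι νg y = σ • ν y →
      ‖ν y‖ = 1 → σ = ‖R.horizontalPart (νg y)‖⁻¹ * ⟪νg y, ν y⟫_ℝ := by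
    intro y h1 σ h2 h3
    rw [← inner_horizontalNormal R h1, h2, real_inner_smul_left, real_inner_self_eq_norm_sq, h3]
    norm_num
  rcases halt.self_of_nhds with ⟨h0 | h0, hV, h1⟩
  · have h2 : 0 < ⟪νg y₀, ν y₀⟫_ℝ := by
      have h3 := hinner y₀ hV 1 (by rw [h0, one_smul]) h1
      exact pos_of_mul_pos_right (h3 ▸ one_pos) (hpos y₀).le
    refine hν.congr_of_eventuallyEq ?_
    filter_upwards [halt, hcont.eventually (lt_mem_nhds h2)] with y ⟨h3, h4, h5⟩ h6
    rcases h3 with h3 | h3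
    · rw [h3]
    · have h7 := hinner y h4 (-1) (by rw [h3, neg_one_smul]) h5
      linarith [mul_pos (hpos y) h6]
  · have h2 : ⟪νg y₀, ν y₀⟫_ℝ < 0 := by
      have h3 := hinner y₀ hV (-1) (by rw [h0, neg_one_smul]) h1
      by_contra! h4
      linarith [mul_nonneg (hpos y₀).le h4]
    refine ((contMDiffAt_const (c := (-1 : ℝ))).smul_along hν).congr_of_eventuallyEq ?_
    filter_upwards [halt, hcont.eventually (gt_mem_nhds h2)] with y ⟨h3, h4, h5⟩ h6
    rcases h3 with h3 | h3
    · have h7 := hinner y h4 1 (by rw [h3, one_smul]) h5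
      linarith [mul_neg_of_pos_of_neg (hpos y) h6]
    · rw [h3, neg_one_smul]

end PerpField

section Curvature

variable {E : Type*} [NormedAddCommGroup E] [NormedSpace ℝ E]
  {H : Type*} [TopologicalSpace H] {I : ModelWithCorners ℝ E H}
  {M : Type*} [TopologicalSpace M] [ChartedSpace H M]
  {F : Type*} [NormedAddCommGroup F] [NormedSpace ℝ F]
  {G : Type*} [TopologicalSpace G] {J : ModelWithCorners ℝ F G}
  {N : Type*} [TopologicalSpace N] [ChartedSpace G N] {ι : N → M}

theorem velocity_comp {γ : ℝ → N} {t : ℝ} (hι : MDifferentiableAt J I ι (γ t))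
    (hγ : MDifferentiableAt 𝓘(ℝ) J γ t) :
    velocity I (ι ∘ γ) t = mfderiv J I ι (γ t) (curveDeriv J γ t) := by
  rw [velocity, mfderiv_comp t hι hγ]
  rfl

/-- The chain rule for the covariant derivative along a curve in a submanifold. -/
theorem covDerivAlong_comp [IsManifold I 1 M]
    (cov : CovariantDerivative I E (fun x : M ↦ TangentSpace I x))
    {W : (y : N) → TangentSpace I (ι y)} {γ : ℝ → N} {t : ℝ}
    (hW : MDifferentiableAt J I.tangent (fun y ↦ (⟨ι y, W y⟩ : TangentBundle I M)) (γ t))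
    (hγ : MDifferentiableAt 𝓘(ℝ) J γ t) :
    covDerivAlong 𝓘(ℝ) cov (ι ∘ γ) (fun s ↦ W (γ s)) t (1 : ℝ) =
      covDerivAlong J cov ι W (γ t) (curveDeriv J γ t) := by
  obtain ⟨h1, h2⟩ := (mdifferentiableAt_totalSpace _ _).1 hW
  have h3 := mfderiv_comp t h2 hγ
  have h4 := mfderiv_comp t h1 hγ
  refine congrArg₂ (· + ·) ?_ ?_
  · exact congrArg (fun L : ℝ →L[ℝ] E ↦
      (trivializationAt E (TangentSpace I) (ι (γ t))).symmL ℝ (ι (γ t)) (L 1)) h3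
  · exact congrArg (fun L : ℝ →L[ℝ] E ↦
      cov (FiberBundle.extend E (W (γ t))) (ι (γ t)) (L 1)) h4

variable [IsManifold I ∞ M] [RiemannianBundle (fun x : M ↦ TangentSpace I x)] {m : ℕ}
  {S : SubRiemannianStructure I M 1} {R : VerticallyRigidComplement S m}
  {νg : (y : N) → TangentSpace I (ι y)}

theorem IsPerpCurveOn.isLineCurve (hι : ContMDiff J I 2 ι) {γ : ℝ → N} {A : Set ℝ}
    (h : IsPerpCurveOn J R ι νg γ A) (hA : IsOpen A) (hA' : A.OrdConnected) :
    IsLineCurve (IsPerpVector J ι R νg) γ A where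
  isOpen := hA
  ordConnected := hA'
  contMDiffAt t ht := h.contMDiffOn.contMDiffAt (hA.mem_nhds ht)
  deriv_mem t ht := by
    have hv := velocity_comp ((hι (γ t)).mdifferentiableAt (by norm_num))
      ((h.contMDiffOn.contMDiffAt (hA.mem_nhds ht)).mdifferentiableAt (by norm_num))
    rw [IsPerpVector, ← hv]
    exact ⟨h.horizontal t ht, h.norm_eq_one t ht, h.orthogonal t ht⟩

theorem IsLineCurve.isPerpCurveOn (hι : ContMDiff J I 2 ι) {γ : ℝ → N} {A : Set ℝ}
    (h : IsLineCurve (IsPerpVector J ι R νg) γ A) : IsPerpCurveOn J R ι νg γ A := by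
  have hv : ∀ t ∈ A, velocity I (ι ∘ γ) t = mfderiv J I ι (γ t) (curveDeriv J γ t) :=
    fun t ht ↦ velocity_comp ((hι (γ t)).mdifferentiableAt (by norm_num))
      ((h.contMDiffAt t ht).mdifferentiableAt (by norm_num))
  refine ⟨fun t ht ↦ (h.contMDiffAt t ht).contMDiffWithinAt, fun t ht ↦ ?_, fun t ht ↦ ?_,
    fun t ht ↦ ?_⟩
  · rw [hv t ht]; exact (h.deriv_mem t ht).1
  · rw [hv t ht]; exact (h.deriv_mem t ht).2.1
  · rw [hv t ht]; exact (h.deriv_mem t ht).2.2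

/-- The curves of the characteristic line field of a CMC(`ρ`) hypersurface have constant horizontal
curvature `-ρ`. -/
theorem IsCMC.horizontalCurvature_eq [FiniteDimensional ℝ E] [FiniteDimensional ℝ F]
    [IsContMDiffRiemannianBundle I ∞ E (fun x : M ↦ TangentSpace I x)] [IsManifold J 2 N]
    {cov : CovariantDerivative I E (fun x : M ↦ TangentSpace I x)} {ρ : ℝ}
    (hρ : IsCMC J R ι νg cov ρ) (hcov : R.IsAdapted cov) (hι : ContMDiff J I 2 ι)
    (hinj : ∀ y, Function.Injective (mfderiv J I ι y))
    (hdim : Module.finrank ℝ E = Module.finrank ℝ F + 1)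
    (hνg : IsUnitNormal J ι νg) (hchar : ∀ y, IsNoncharacteristicAt J S ι y)
    {γ : ℝ → N} {A : Set ℝ} (h : IsLineCurve (IsPerpVector J ι R νg) γ A)
    (hγ : ∀ t ∈ A, ContMDiffAt 𝓘(ℝ) J 2 γ t) {t : ℝ} (ht : t ∈ A) :
    horizontalCurvature R ι νg cov γ t = -ρ := by
  have : IsManifold J 1 N := .of_le (n := 2) (by norm_num)
  have hγd := (h.contMDiffAt t ht).mdifferentiableAt (by norm_num)
  have hν := (contMDiffAt_horizontalNormal R hι hinj hdim hνg hchar (γ t)).mdifferentiableAt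
    (by norm_num)
  have hW : MDifferentiableAt 𝓘(ℝ) I.tangent
      (fun s ↦ (⟨(ι ∘ γ) s, velocity I (ι ∘ γ) s⟩ : TangentBundle I M)) t :=
    ((((hι (γ t)).comp t (hγ t ht)).curveDeriv (m := 1) (by norm_num))).mdifferentiableAt
      (by norm_num)
  have hZ : MDifferentiableAt 𝓘(ℝ) I.tangent
      (fun s ↦ (⟨(ι ∘ γ) s, horizontalNormal R ι νg (γ s)⟩ : TangentBundle I M)) t :=
    MDifferentiableAt.comp
      (g := fun y ↦ (⟨ι y, horizontalNormal R ι νg y⟩ : TangentBundle I M)) t hν hγd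
  have h1 := hasDerivAt_inner_along hcov.metric hW hZ
  have h2 : HasDerivAt (fun s ↦ inner ℝ (E := TangentSpace I (ι (γ s))) (velocity I (ι ∘ γ) s)
      (horizontalNormal R ι νg (γ s))) 0 t := by
    refine (hasDerivAt_const t (0 : ℝ)).congr_of_eventuallyEq ?_
    filter_upwards [h.isOpen.mem_nhds ht] with s hs
    exact (h.isPerpCurveOn hι).orthogonal s hs
  have h3 := h1.unique h2
  have hv := velocity_comp ((hι (γ t)).mdifferentiableAt (by norm_num)) hγd
  obtain ⟨p1, p2, p3⟩ := h.deriv_mem t ht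
  have h4 := hρ (γ t) (fun _ ↦ curveDeriv J γ t) ⟨fun _ ↦ p1, fun _ ↦ p2,
    fun i j hij ↦ (hij (Subsingleton.elim i j)).elim⟩
  have h5 : ⟪covDerivAlong J cov ι (horizontalNormal R ι νg) (γ t) (curveDeriv J γ t),
      mfderiv J I ι (γ t) (curveDeriv J γ t)⟫_ℝ = ρ := by
    rw [← h4, Matrix.trace, Fin.sum_univ_one]
    rfl
  rw [covDerivAlong_comp cov hν hγd, hv] at h3
  have h6 : horizontalCurvature R ι νg cov γ t + ρ = 0 := by
    rw [← h5, real_inner_comm]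
    exact h3
  exact eq_neg_of_add_eq_zero_left h6

end Curvature

theorem mainTheorem6 {n m : ℕ}
    {M : Type*} [TopologicalSpace M] [T2Space M]
    [ChartedSpace (EuclideanSpace ℝ (Fin (n + 1))) M]
    [IsManifold (𝓡 (n + 1)) ∞ M]
    [RiemannianBundle (fun x : M ↦ TangentSpace (𝓡 (n + 1)) x)]
    [IsContMDiffRiemannianBundle (𝓡 (n + 1)) ∞ (EuclideanSpace ℝ (Fin (n + 1)))
      (fun x : M ↦ TangentSpace (𝓡 (n + 1)) x)]
    (S : SubRiemannianStructure (𝓡 (n + 1)) M 1) (R : VerticallyRigidComplement S m)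
    (cov : CovariantDerivative (𝓡 (n + 1)) (EuclideanSpace ℝ (Fin (n + 1)))
      (fun x : M ↦ TangentSpace (𝓡 (n + 1)) x))
    (hcov : R.IsAdapted cov)
    {N : Type*} [TopologicalSpace N] [T2Space N] [ChartedSpace (EuclideanSpace ℝ (Fin n)) N]
    [IsManifold (𝓡 n) 2 N]
    (ι : N → M) (hι : Manifold.IsImmersion (𝓡 n) (𝓡 (n + 1)) 2 ι)
    (νg : (y : N) → TangentSpace (𝓡 (n + 1)) (ι y)) (hνg : IsUnitNormal (𝓡 n) ι νg)
    (hchar : ∀ y, IsNoncharacteristicAt (𝓡 n) S ι y)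
    (ρ : ℝ) (hρ : IsCMC (𝓡 n) R ι νg cov ρ) :
    (∃ leaves : Set (Set N), Setoid.IsPartition leaves ∧
      ∀ L ∈ leaves, ∃ (γ : ℝ → N) (A : Set ℝ), IsOpen A ∧ A.OrdConnected ∧
        IsPerpCurveOn (𝓡 n) R ι νg γ A ∧ L = γ '' A) ∧
    ∀ (γ : ℝ → N) (A : Set ℝ), IsOpen A → A.OrdConnected →
      IsPerpCurveOn (𝓡 n) R ι νg γ A →
        ContMDiffOn 𝓘(ℝ) (𝓡 n) 2 γ A ∧
        ∀ t ∈ A, horizontalCurvature R ι νg cov γ t = -ρ := by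
  have : IsManifold (𝓡 n) 1 N := .of_le (n := 2) (by norm_num)
  have hdim : Module.finrank ℝ (EuclideanSpace ℝ (Fin (n + 1))) =
      Module.finrank ℝ (EuclideanSpace ℝ (Fin n)) + 1 := by simp
  have hinj : ∀ y, Function.Injective (mfderiv (𝓡 n) (𝓡 (n + 1)) ι y) := fun y ↦
    (hι.isImmersionAt y).mfderiv_injective two_ne_zero
  have hP := isLineField_isPerpVector R hι.contMDiff hinj hdim hνg hchar
  refine ⟨?_, fun γ A hA hA' h ↦ ?_⟩
  · obtain ⟨leaves, h1, h2⟩ := hP.exists_isPartition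
    refine ⟨leaves, h1, fun L hL ↦ ?_⟩
    obtain ⟨γ, A, h3, h4⟩ := h2 L hL
    exact ⟨γ, A, h3.isOpen, h3.ordConnected, h3.isPerpCurveOn hι.contMDiff, h4⟩
  · have h1 := h.isLineCurve hι.contMDiff hA hA'
    have h2 : ∀ t ∈ A, ContMDiffAt 𝓘(ℝ) (𝓡 n) 2 γ t := fun t ht ↦ h1.contMDiffAt_two hP ht
    exact ⟨fun t ht ↦ (h2 t ht).contMDiffWithinAt, fun t ht ↦
      hρ.horizontalCurvature_eq hcov hι.contMDiff hinj hdim hνg hchar h1 h2 ht⟩
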